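/- For real parameters with $0<1/t<1/a<b<t$ let $(v_1,\dots,v_8)=(-t,-a,-1/b,-1/t,1/t,1/a,b,t)$ and consider on the closed upper half plane the $1$-forms (the Weierstrass data, with L\'opez--Ros factor $\rho=1$, on which $Q$ below does not depend) $$\phi_1=-\frac{(z+a)^{1/2}(z+1/b)^{-1/2}(z-1/a)^{1/2}(z-b)^{-1/2}}{(z+t)^{1/2}(z+1/t)^{1/2}(z-1/t)^{1/2}(z-t)^{1/2}}\,dz,\qquad \phi_2=\frac{(z+a)^{-1/2}(z+1/b)^{1/2}(z-1/a)^{-1/2}(z-b)^{1/2}}{(z+t)^{1/2}(z+1/t)^{1/2}(z-1/t)^{1/2}(z-t)^{1/2}}\,dz .$$ Put $I_k=\bigl|\int_{v_k}^{v_{k+1}}\phi_1\bigr|$, $J_k=\bigl|\int_{v_k}^{v_{k+1}}\phi_2\bigr|$ and $$Q(a,b;t)=\frac{I_1+I_3}{I_2}-\frac{J_1+J_3}{J_2}.$$ Define subsets of $\mathbb R^3$ by $$\mathrm{oP}=\{(a,b,t): Q(a,b;t)=0,\ a=b,\ 0<1/t<1/a<b<t\},\qquad \mathrm{oH}=\{(a,b,t):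 Q(a,b;t)=0,\ a\neq b,\ 0<1/t<1/a<b<t\}.$$ Let $K(m)=\int_0^{\pi/2}\frac{d\theta}{\sqrt{1-m\sin^2\theta}}$, $E(m)=\int_0^{\pi/2}\sqrt{1-m\sin^2\theta}\,d\theta$, $\bar K(m)=K(1-m)$, $\bar E(m)=E(1-m)$, and for $0<\alpha<\tau$ $$m_1=\frac{\alpha^2+4}{\tau^2+4},\qquad m_2=\frac{\alpha^2}{\tau^2}\,\frac{\tau^2+4}{\alpha^2+4}.$$ **Theorem.** 1. With $\alpha=a-1/a$, $\beta=b-1/b$, $\tau=t-1/t$ (so that $-\tau<-\alpha<\beta<\tau$) and $\zeta=z-1/z$, one has $Q(a,b;t)=Q(\alpha,\beta;\tau)$, where $Q(\alpha,\beta;\tau)$ is defined by the same formula with $I_k,J_k$ ($k=1,2,3$) the absolute values of the integrals, over the consecutive intervals with end points $-\tau,-\alpha,\beta,\tau$, of $$\varphi_1=-\frac{(\zeta+\alpha)^{1/2}(\zeta-\beta)^{-1/2}}{(\zeta^2-\tau^2)^{1/2}(\zeta^2+4)^{1/2}}\,d\zeta,\qquad \varphi_2=\frac{(\zeta+\alpha)^{-1/2}(\zeta-\beta)^{1/2}}{(\zeta^2-\tau^2)^{1/2}(\zeta^2+4)^{1/2}}\,d\zeta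 .$$ 2. If $0<\alpha<\tau$, then $0<m_1<1$ and $0<m_2<1$. 3. The intersection $\overline{\mathrm{oH}}\cap\mathrm{oP}$ (closure in $\mathbb R^3$) is exactly the set of all $(a,b,t)$ with $a=b$ and $0<1/t<1/a<b<t$ such that, for $\alpha=a-1/a$ and $\tau=t-1/t$, $$\bar K(m_1)E(m_2)+m_2\,\bar E(m_1)K(m_2)=\bar K(m_1)K(m_2).$$ 4. The function $\tilde Q(\alpha,\beta;\tau)=\dfrac{Q(\alpha,\beta;\tau)}{\beta-\alpha}$, defined for $-\tau<-\alpha<\beta<\tau$ and $\alpha\neq\beta$, extends to a real analytic function on the whole domain $\{-\tau<-\alpha<\beta<\tau\}$, and for $0<\alpha<\tau$ the extension satisfies $$\tilde Q(\alpha,\alpha;\tau)=\frac{\tau^2}{\alpha^2}\,\frac{\tau}{\tau^2-\alpha^2}\sqrt{\frac{\alpha^2+4}{\tau^2+4}}\;\frac{\bar K(m_1)K(m_2)-\bar K(m_1)E(m_2)-m_2\,\bar E(m_1)K(m_2)}{K(m_2)^2}.$$ -/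

import Mathlib

namespace OrthoTPMS

noncomputable section

/-- The preimages `v₁ < v₂ < … < v₈` of the vertices of the minimal octagon. -/
def vertex (a b t : ℝ) : ℕ → ℝ
  | 1 => -t
  | 2 => -a
  | 3 => -(1 / b)
  | 4 => -(1 / t)
  | 5 => 1 / t
  | 6 => 1 / a
  | 7 => b
  | 8 => t
  | _ => 0

/-- The common denominator of the Schwarz-Christoffel integrands. The principal complex powers are
at real points the boundary values of the branches on the upper half plane. -/
def denom (t : ℝ) (z : ℂ) : ℂ :=
  (z + t) ^ (1 / 2 : ℂ) * (z + 1 / t) ^ (1 / 2 : ℂ) * (z - 1 / t) ^ (1 / 2 : ℂ) *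
    (z - t) ^ (1 / 2 : ℂ)

/-- The integrand of the `1`-form `dh * G`, with the Lopez-Ros factor taken to be `1`. -/
def phi1 (a b t : ℝ) (z : ℂ) : ℂ :=
  -((z + a) ^ (1 / 2 : ℂ) * (z + 1 / b) ^ (-1 / 2 : ℂ) * (z - 1 / a) ^ (1 / 2 : ℂ) *
    (z - b) ^ (-1 / 2 : ℂ) / denom t z)

/-- The integrand of the `1`-form `dh / G`, with the Lopez-Ros factor taken to be `1`. -/
def phi2 (a b t : ℝ) (z : ℂ) : ℂ :=
  (z + a) ^ (-1 / 2 : ℂ) * (z + 1 / b) ^ (1 / 2 : ℂ) * (z - 1 / a) ^ (-1 / 2 : ℂ) *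
    (z - b) ^ (1 / 2 : ℂ) / denom t z

/-- The edge length `I_k` of the Euclidean octagon of `phi1`. -/
def edgeI (a b t : ℝ) (k : ℕ) : ℝ :=
  ‖∫ x in (vertex a b t k)..(vertex a b t (k + 1)), phi1 a b t (x : ℂ)‖

/-- The edge length `J_k` of the Euclidean octagon of `phi2`. -/
def edgeJ (a b t : ℝ) (k : ℕ) : ℝ :=
  ‖∫ x in (vertex a b t k)..(vertex a b t (k + 1)), phi2 a b t (x : ℂ)‖

/-- The period quotient `Q(a, b; t)`. -/
def Q (a b t : ℝ) : ℝ :=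
  (edgeI a b t 1 + edgeI a b t 3) / edgeI a b t 2 -
    (edgeJ a b t 1 + edgeJ a b t 3) / edgeJ a b t 2

/-- The Meeks locus. -/
def oP : Set (ℝ × ℝ × ℝ) :=
  {p | ∃ a b t : ℝ, p = (a, b, t) ∧ Q a b t = 0 ∧ a = b ∧
    0 < 1 / t ∧ 1 / t < 1 / a ∧ 1 / a < b ∧ b < t}

/-- The non-Meeks locus. -/
def oH : Set (ℝ × ℝ × ℝ) :=
  {p | ∃ a b t : ℝ, p = (a, b, t) ∧ Q a b t = 0 ∧ a ≠ b ∧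
    0 < 1 / t ∧ 1 / t < 1 / a ∧ 1 / a < b ∧ b < t}

/-- The points `ζ = z - 1 / z` for `z = v₁, …, v₄`. -/
def simpleVertex (α β τ : ℝ) : ℕ → ℝ
  | 1 => -τ
  | 2 => -α
  | 3 => β
  | 4 => τ
  | _ => 0

/-- The integrand of the first `1`-form in the variable `ζ = z - 1 / z`, on the real axis. -/
def varphi1 (α β τ : ℝ) (ζ : ℂ) : ℂ :=
  -((ζ + α) ^ (1 / 2 : ℂ) * (ζ - β) ^ (-1 / 2 : ℂ) * (ζ ^ 2 - τ ^ 2) ^ (-1 / 2 : ℂ) *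
    (ζ ^ 2 + 4) ^ (-1 / 2 : ℂ))

/-- The integrand of the second `1`-form in the variable `ζ = z - 1 / z`, on the real axis. -/
def varphi2 (α β τ : ℝ) (ζ : ℂ) : ℂ :=
  (ζ + α) ^ (-1 / 2 : ℂ) * (ζ - β) ^ (1 / 2 : ℂ) * (ζ ^ 2 - τ ^ 2) ^ (-1 / 2 : ℂ) *
    (ζ ^ 2 + 4) ^ (-1 / 2 : ℂ)

/-- `I_k` in the parameters `α, β, τ`, for `k = 1, 2, 3`. -/
def simpleI (α β τ : ℝ) (k : ℕ) : ℝ :=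
  ‖∫ x in (simpleVertex α β τ k)..(simpleVertex α β τ (k + 1)), varphi1 α β τ (x : ℂ)‖

/-- `J_k` in the parameters `α, β, τ`, for `k = 1, 2, 3`. -/
def simpleJ (α β τ : ℝ) (k : ℕ) : ℝ :=
  ‖∫ x in (simpleVertex α β τ k)..(simpleVertex α β τ (k + 1)), varphi2 α β τ (x : ℂ)‖

/-- The period quotient `Q(α, β; τ)`. -/
def simpleQ (α β τ : ℝ) : ℝ :=
  (simpleI α β τ 1 + simpleI α β τ 3) / simpleI α β τ 2 -
    (simpleJ α β τ 1 + simpleJ α β τ 3) / simpleJ α β τ 2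

/-- The parameter domain `-τ < -α < β < τ`. -/
def simpleDomain : Set (ℝ × ℝ × ℝ) :=
  {p | -p.2.2 < -p.1 ∧ -p.1 < p.2.1 ∧ p.2.1 < p.2.2}

/-- The complete elliptic integral of the first kind, as a function of the parameter `m`. -/
def ellipticK (m : ℝ) : ℝ :=
  ∫ θ in (0 : ℝ)..(Real.pi / 2), 1 / Real.sqrt (1 - m * Real.sin θ ^ 2)

/-- The complete elliptic integral of the second kind, as a function of the parameter `m`. -/
def ellipticE (m : ℝ) : ℝ :=
  ∫ θ in (0 : ℝ)..(Real.pi / 2), Real.sqrt (1 - m * Real.sin θ ^ 2)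

/-- The associated elliptic integral of the first kind. -/
def ellipticKbar (m : ℝ) : ℝ := ellipticK (1 - m)

/-- The associated elliptic integral of the second kind. -/
def ellipticEbar (m : ℝ) : ℝ := ellipticE (1 - m)

def m₁ (α τ : ℝ) : ℝ := (α ^ 2 + 4) / (τ ^ 2 + 4)

def m₂ (α τ : ℝ) : ℝ := α ^ 2 / τ ^ 2 * ((τ ^ 2 + 4) / (α ^ 2 + 4))

end

end OrthoTPMS

/-! On each edge every factor under a root keeps its sign, so the integrand is a constant unit phase
times a positive function and the edge length is the integral of the absolute value
(`HasConstPhase.norm_integral`). The first claim is then the real substitution ζ = z - 1/z on [-t,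
-1/t], whose Jacobian cancels against √(ζ² + 4).

The reflection ζ ↦ -ζ exchanges the two forms together with α and β. Hence Q(α, β; τ) = F(α, β) -
F(β, α) for a single F (`simpleQ_eq`), and Q vanishes on the diagonal. The substitution z = (p +
q)/2 + (q - p)/2 · sin θ removes the end point singularities and places all integrals on [-π/2,
π/2]. There the difference of two integrands is divisible by β - α by elementary algebra, which
gives Q = (β - α) · `quotQ` (`simpleQ_eq_mul_quotQ`). Analyticity of `quotQ` comes from viewing each
integrand as an analytic map into the Banach algebra C([a, b]), on which integration is continuous
and linear.

On the diagonal the divided differences are, up to elementary factors, the α-derivatives of the two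
integrals `midM` and `sideN`. These are complete elliptic integrals, with values in K(m₂) and
K̄(m₁), and the formula for dK/dm yields the closed form `quotQ_diag`: a positive factor times
`diagH`.

For the closure, `quotQ` is continuous and vanishes on oH, so limits of oH on the diagonal satisfy
`diagH` = 0. Conversely, (m₁, m₂) are coordinates on 0 < α < τ, and with m₂ fixed, near a zero,
`diagH` is strictly decreasing in m₁. So both signs occur near the zero; they persist slightly above
the diagonal, and the intermediate value theorem on a convex set produces zeros of `quotQ` with α <
β arbitrarily close. -/

namespace OrthoTPMS

section Proof

open Set Filter Topology MeasureTheory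

/-! ### Analytic square root and inverse in the algebra C(K, ℝ). -/

section ContinuousMapAlgebra

variable {K : Type*} [TopologicalSpace K] [CompactSpace K]

/-- The pointwise square root is analytic near a positive function. -/
theorem exists_analyticAt_sqrt (w : C(K, ℝ)) (hw : ∀ x, 0 < w x) :
    ∃ r : C(K, ℝ) → C(K, ℝ), AnalyticAt ℝ r w ∧ ∀ᶠ v in 𝓝 w, ∀ x, r v x = √(v x) := by
  set s : C(K, ℝ) := ⟨fun x => √(w x), by fun_prop⟩ with hs
  set s' : C(K, ℝ) := ⟨fun x => (2 * √(w x))⁻¹,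
    Continuous.inv₀ (by fun_prop) fun x => by have := Real.sqrt_pos.2 (hw x); positivity⟩ with hs'
  have hss : ∀ u : C(K, ℝ), s' * ((2 : ℝ) • (s * u)) = u := fun u => by
    ext x
    have := (Real.sqrt_pos.2 (hw x)).ne'
    simp only [hs, hs', ContinuousMap.coe_mul, Pi.mul_apply, ContinuousMap.coe_mk,
      ContinuousMap.coe_smul, Pi.smul_apply, smul_eq_mul]
    field_simp
  have hss' : ∀ u : C(K, ℝ), (2 : ℝ) • (s * (s' * u)) = u := fun u => by
    rw [← hss u]
    conv_rhs => rw [← hss u]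
    rw [hss u]
    ext x
    simp only [ContinuousMap.coe_mul, Pi.mul_apply, ContinuousMap.coe_smul, Pi.smul_apply,
      smul_eq_mul]
    ring
  have hsq : s * s = w := by
    ext x
    simp [hs, Real.mul_self_sqrt (hw x).le]
  -- The derivative of squaring at s = √w is u ↦ 2su, invertible because s has no zeros; the inverse
  -- function theorem applies.
  let i : C(K, ℝ) ≃L[ℝ] C(K, ℝ) := ContinuousLinearEquiv.equivOfInverse
    ((2 : ℝ) • ContinuousLinearMap.mul ℝ C(K, ℝ) s) (ContinuousLinearMap.mul ℝ C(K, ℝ) s')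
    (fun u => by simpa using hss u) (fun u => by simpa using hss' u)
  let f : C(K, ℝ) → C(K, ℝ) := fun u => u * u
  have hfa : AnalyticAt ℝ f s := analyticAt_id.mul analyticAt_id
  have hf : HasStrictFDerivAt f (i : C(K, ℝ) →L[ℝ] C(K, ℝ)) s := by
    have h := (hasStrictFDerivAt_id (𝕜 := ℝ) s).mul (hasStrictFDerivAt_id (𝕜 := ℝ) s)
    refine h.congr_fderiv ?_
    ext u x
    simp [i]
    ring
  let R := hf.toOpenPartialHomeomorph f
  have hmem : s ∈ R.source := hf.mem_toOpenPartialHomeomorph_source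
  have hRs : R s = w := hsq
  have hwt : w ∈ R.target := hRs ▸ R.map_source hmem
  have hsymm : R.symm w = s := by rw [← hRs]; exact R.left_inv hmem
  refine ⟨R.symm, ?_, ?_⟩
  · rw [← hRs]
    exact R.analyticAt_symm' hmem hfa hf.hasFDerivAt.fderiv
  -- The local inverse stays close to s > 0, so among the square roots of v it selects the positive
  -- one.
  · have hpos : ∀ᶠ u in 𝓝 s, ∀ x, 0 < u x := by
      have : IsOpen {u : C(K, ℝ) | MapsTo u univ (Ioi 0)} :=
        ContinuousMap.isOpen_setOfPred_mapsTo isCompact_univ isOpen_Ioi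
      filter_upwards [this.mem_nhds (fun x _ => Real.sqrt_pos.2 (hw x))] with u hu x
        using hu (mem_univ x)
    have hcont : Tendsto R.symm (𝓝 w) (𝓝 s) := by
      have := R.continuousAt_symm hwt
      rwa [ContinuousAt, hsymm] at this
    filter_upwards [hcont.eventually hpos, R.open_target.mem_nhds hwt] with v hv hvt x
    have h : R.symm v * R.symm v = v := R.right_inv hvt
    have hx : R.symm v x * R.symm v x = v x := congrArg (fun u : C(K, ℝ) => u x) h
    rw [← hx, Real.sqrt_mul_self (hv x).le]

/-- The pointwise inverse is analytic near a function without zeros. -/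
theorem exists_analyticAt_inv (w : C(K, ℝ)) (hw : ∀ x, w x ≠ 0) :
    ∃ r : C(K, ℝ) → C(K, ℝ), AnalyticAt ℝ r w ∧ ∀ᶠ v in 𝓝 w, ∀ x, r v x = (v x)⁻¹ := by
  have hu : IsUnit w := (ContinuousMap.isUnit_iff_forall_ne_zero w).2 hw
  refine ⟨Ring.inverse, analyticAt_inverse hu.unit, ?_⟩
  filter_upwards [Units.nhds hu.unit] with v hv x
  have h : v * Ring.inverse v = 1 := Ring.mul_inverse_cancel v hv
  have hx : v x * Ring.inverse v x = 1 := congrArg (fun u : C(K, ℝ) => u x) h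
  exact eq_inv_of_mul_eq_one_right hx

end ContinuousMapAlgebra

/-! ### Analytic dependence of integrals on parameters. -/

section ParametricIntegral

/-- Integration over `[a, b]` as a continuous linear functional on `C([a, b])`. -/
noncomputable def integralIcc {a b : ℝ} (hab : a ≤ b) : C(Icc a b, ℝ) →L[ℝ] ℝ :=
  LinearMap.mkContinuous
    { toFun := fun F => ∫ θ in a..b, F (projIcc a b hab θ)
      map_add' := fun F G => by
        simp only [ContinuousMap.coe_add, Pi.add_apply]
        exact intervalIntegral.integral_add
          (Continuous.intervalIntegrable (F.continuous.comp continuous_projIcc) _ _)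
          (Continuous.intervalIntegrable (G.continuous.comp continuous_projIcc) _ _)
      map_smul' := fun c F => by simp } (b - a)
    (fun F => by
      have := intervalIntegral.norm_integral_le_of_norm_le_const (a := a) (b := b) (C := ‖F‖)
        (f := fun θ => F (projIcc a b hab θ)) fun θ _ => F.norm_coe_le_norm _
      rw [abs_of_nonneg (sub_nonneg.2 hab)] at this
      simpa [mul_comm] using this)

theorem integralIcc_eq {a b : ℝ} (hab : a ≤ b) {F : C(Icc a b, ℝ)} {f : ℝ → ℝ}
    (h : ∀ θ : Icc a b, F θ = f θ) : integralIcc hab F = ∫ θ in a..b, f θ := by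
  refine intervalIntegral.integral_congr fun θ hθ => ?_
  rw [uIcc_of_le hab] at hθ
  simp [h, projIcc_of_mem hab hθ]

variable {E : Type*} [NormedAddCommGroup E] [NormedSpace ℝ E]

/-- The function `f x`, restricted to `[a, b]`, depends analytically on `x` near `x₀` in the
uniform norm. -/
def UnifAnalyticAt (a b : ℝ) (f : E → ℝ → ℝ) (x₀ : E) : Prop :=
  ∃ F : E → C(Icc a b, ℝ), AnalyticAt ℝ F x₀ ∧ ∀ᶠ x in 𝓝 x₀, ∀ θ : Icc a b, F x θ = f x θ

namespace UnifAnalyticAt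

variable {a b : ℝ} {f g : E → ℝ → ℝ} {x₀ : E}

theorem of_analyticAt {c : E → ℝ} (hc : AnalyticAt ℝ c x₀) :
    UnifAnalyticAt a b (fun x _ => c x) x₀ :=
  ⟨fun x => algebraMap ℝ C(Icc a b, ℝ) (c x),
    ((algebraMapCLM ℝ C(Icc a b, ℝ)).analyticAt _).comp hc, .of_forall fun _ _ => rfl⟩

theorem of_continuous {c : ℝ → ℝ} (hc : Continuous c) :
    UnifAnalyticAt a b (fun _ θ => c θ) x₀ :=
  ⟨fun _ => ⟨fun θ => c θ, by fun_prop⟩, analyticAt_const, .of_forall fun _ _ => rfl⟩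

theorem add (hf : UnifAnalyticAt a b f x₀) (hg : UnifAnalyticAt a b g x₀) :
    UnifAnalyticAt a b (fun x θ => f x θ + g x θ) x₀ := by
  obtain ⟨F, hF, hFf⟩ := hf
  obtain ⟨G, hG, hGg⟩ := hg
  refine ⟨fun x => F x + G x, hF.add hG, ?_⟩
  filter_upwards [hFf, hGg] with x h₁ h₂ θ
  simp [h₁, h₂]

theorem mul (hf : UnifAnalyticAt a b f x₀) (hg : UnifAnalyticAt a b g x₀) :
    UnifAnalyticAt a b (fun x θ => f x θ * g x θ) x₀ := by
  obtain ⟨F, hF, hFf⟩ := hf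
  obtain ⟨G, hG, hGg⟩ := hg
  refine ⟨fun x => F x * G x, hF.mul hG, ?_⟩
  filter_upwards [hFf, hGg] with x h₁ h₂ θ
  simp [h₁, h₂]

theorem const (c : ℝ) : UnifAnalyticAt a b (fun _ _ => c) x₀ := of_analyticAt analyticAt_const

theorem neg (hf : UnifAnalyticAt a b f x₀) : UnifAnalyticAt a b (fun x θ => -f x θ) x₀ := by
  simpa using (const (-1)).mul hf

theorem sub (hf : UnifAnalyticAt a b f x₀) (hg : UnifAnalyticAt a b g x₀) :
    UnifAnalyticAt a b (fun x θ => f x θ - g x θ) x₀ := by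
  simpa only [sub_eq_add_neg] using hf.add hg.neg

theorem pow (hf : UnifAnalyticAt a b f x₀) (n : ℕ) :
    UnifAnalyticAt a b (fun x θ => f x θ ^ n) x₀ := by
  induction n with
  | zero => simpa using const 1
  | succ n ih => simpa only [pow_succ] using ih.mul hf

/-- Positivity at x₀ alone suffices: by compactness it persists in a uniform neighbourhood. -/
theorem sqrt (hf : UnifAnalyticAt a b f x₀) (hpos : ∀ θ ∈ Icc a b, 0 < f x₀ θ) :
    UnifAnalyticAt a b (fun x θ => √(f x θ)) x₀ := by
  obtain ⟨F, hF, hFf⟩ := hf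
  obtain ⟨r, hr, hrs⟩ := exists_analyticAt_sqrt (F x₀) fun θ => by
    rw [hFf.self_of_nhds θ]; exact hpos θ θ.2
  refine ⟨fun x => r (F x), hr.comp hF, ?_⟩
  filter_upwards [hFf, hF.continuousAt.eventually hrs] with x h₁ h₂ θ
  rw [h₂, h₁]

theorem inv (hf : UnifAnalyticAt a b f x₀) (hne : ∀ θ ∈ Icc a b, f x₀ θ ≠ 0) :
    UnifAnalyticAt a b (fun x θ => (f x θ)⁻¹) x₀ := by
  obtain ⟨F, hF, hFf⟩ := hf
  obtain ⟨r, hr, hrs⟩ := exists_analyticAt_inv (F x₀) fun θ => by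
    rw [hFf.self_of_nhds θ]; exact hne θ θ.2
  refine ⟨fun x => r (F x), hr.comp hF, ?_⟩
  filter_upwards [hFf, hF.continuousAt.eventually hrs] with x h₁ h₂ θ
  rw [h₂, h₁]

theorem div (hf : UnifAnalyticAt a b f x₀) (hg : UnifAnalyticAt a b g x₀)
    (hne : ∀ θ ∈ Icc a b, g x₀ θ ≠ 0) : UnifAnalyticAt a b (fun x θ => f x θ / g x θ) x₀ := by
  simpa only [div_eq_mul_inv] using hf.mul (hg.inv hne)

theorem analyticAt_integral (hab : a ≤ b) (hf : UnifAnalyticAt a b f x₀) :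
    AnalyticAt ℝ (fun x => ∫ θ in a..b, f x θ) x₀ := by
  obtain ⟨F, hF, hFf⟩ := hf
  refine (((integralIcc hab).analyticAt _).comp hF).congr ?_
  filter_upwards [hFf] with x hx
  exact integralIcc_eq hab hx

theorem intervalIntegrable (hab : a ≤ b) (hf : UnifAnalyticAt a b f x₀) :
    IntervalIntegrable (f x₀) volume a b := by
  obtain ⟨F, -, hFf⟩ := hf
  refine ContinuousOn.intervalIntegrable_of_Icc hab (continuousOn_iff_continuous_domRestrict.2 ?_)
  exact (F x₀).continuous.congr fun θ => hFf.self_of_nhds θ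

theorem hasDerivAt_integral {f : ℝ → ℝ → ℝ} {f' : ℝ → ℝ} {x₀ : ℝ} (hab : a ≤ b)
    (hf : UnifAnalyticAt a b f x₀) (hd : ∀ θ ∈ Icc a b, HasDerivAt (f · θ) (f' θ) x₀) :
    HasDerivAt (fun x => ∫ θ in a..b, f x θ) (∫ θ in a..b, f' θ) x₀ := by
  obtain ⟨F, hF, hFf⟩ := hf
  have hFd := hF.differentiableAt.hasDerivAt
  have h := (integralIcc hab).hasFDerivAt.comp_hasDerivAt x₀ hFd
  -- Evaluation at θ is continuous and linear, so the derivative of F in the uniform norm is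
  -- pointwise the derivative f'.
  have key : integralIcc hab (deriv F x₀) = ∫ θ in a..b, f' θ := integralIcc_eq hab fun θ => by
    have hev := (ContinuousMap.evalCLM ℝ θ).hasFDerivAt.comp_hasDerivAt x₀ hFd
    refine hev.unique ((hd θ θ.2).congr_of_eventuallyEq ?_)
    filter_upwards [hFf] with x hx using hx θ
  rw [← key]
  refine h.congr_of_eventuallyEq ?_
  filter_upwards [hFf] with x hx
  exact (integralIcc_eq hab hx).symm

end UnifAnalyticAt

end ParametricIntegral

/-! ### Integrands of constant phase. -/

section Phase

/-- On `s`, the complex function `f` is a constant unit phase times the real function `g`. -/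
def HasConstPhase (s : Set ℝ) (f : ℝ → ℂ) (g : ℝ → ℝ) : Prop :=
  ∃ c : ℂ, ‖c‖ = 1 ∧ ∀ x ∈ s, f x = c * g x

namespace HasConstPhase

variable {s : Set ℝ} {f f₁ f₂ : ℝ → ℂ} {g g₁ g₂ : ℝ → ℝ}

theorem mul (h₁ : HasConstPhase s f₁ g₁) (h₂ : HasConstPhase s f₂ g₂) :
    HasConstPhase s (fun x => f₁ x * f₂ x) (fun x => g₁ x * g₂ x) := by
  obtain ⟨c₁, hc₁, h₁⟩ := h₁
  obtain ⟨c₂, hc₂, h₂⟩ := h₂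
  refine ⟨c₁ * c₂, by simp [hc₁, hc₂], fun x hx => ?_⟩
  simp only [h₁ x hx, h₂ x hx]
  push_cast
  ring

theorem div (h₁ : HasConstPhase s f₁ g₁) (h₂ : HasConstPhase s f₂ g₂) :
    HasConstPhase s (fun x => f₁ x / f₂ x) (fun x => g₁ x / g₂ x) := by
  obtain ⟨c₁, hc₁, h₁⟩ := h₁
  obtain ⟨c₂, hc₂, h₂⟩ := h₂
  refine ⟨c₁ / c₂, by simp [hc₁, hc₂], fun x hx => ?_⟩
  simp only [h₁ x hx, h₂ x hx]
  push_cast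
  exact mul_div_mul_comm _ _ _ _

theorem neg (h : HasConstPhase s f g) : HasConstPhase s (fun x => -f x) g := by
  obtain ⟨c, hc, h⟩ := h
  exact ⟨-c, by simp [hc], fun x hx => by simp only [h x hx, neg_mul]⟩

/-- For x < 0 the principal power is x ^ r = exp(iπr) |x| ^ r, so the phase depends only on the
sign. -/
theorem cpow {ℓ : ℝ → ℝ} (r : ℝ) (h : (∀ x ∈ s, 0 < ℓ x) ∨ ∀ x ∈ s, ℓ x < 0) :
    HasConstPhase s (fun x => (ℓ x : ℂ) ^ (r : ℂ)) (fun x => |ℓ x| ^ r) := by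
  rcases h with h | h
  · refine ⟨1, by simp, fun x hx => ?_⟩
    simp only [abs_of_pos (h x hx), one_mul, Complex.ofReal_cpow (h x hx).le]
  · refine ⟨Complex.exp (Real.pi * Complex.I * r), ?_, fun x hx => ?_⟩
    · rw [show (Real.pi * Complex.I * r : ℂ) = ((Real.pi * r : ℝ) : ℂ) * Complex.I by
        push_cast; ring]
      exact Complex.norm_exp_ofReal_mul_I _
    · beta_reduce
      rw [Complex.ofReal_cpow_of_nonpos (h x hx).le, abs_of_neg (h x hx), mul_comm,
        ← Complex.ofReal_neg, Complex.ofReal_cpow (neg_pos.2 (h x hx)).le]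

theorem cpow_half {F : ℝ → ℂ} {ℓ : ℝ → ℝ} (hF : ∀ x, F x = ℓ x)
    (h : (∀ x ∈ s, 0 < ℓ x) ∨ ∀ x ∈ s, ℓ x < 0) :
    HasConstPhase s (fun x => F x ^ (1 / 2 : ℂ)) (fun x => √|ℓ x|) := by
  simpa [hF, Real.sqrt_eq_rpow] using cpow (1 / 2) h

theorem cpow_neg_half {F : ℝ → ℂ} {ℓ : ℝ → ℝ} (hF : ∀ x, F x = ℓ x)
    (h : (∀ x ∈ s, 0 < ℓ x) ∨ ∀ x ∈ s, ℓ x < 0) :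
    HasConstPhase s (fun x => F x ^ (-1 / 2 : ℂ)) (fun x => (√|ℓ x|)⁻¹) := by
  have := cpow (-1 / 2) h
  have e : ∀ x : ℝ, |x| ^ (-1 / 2 : ℝ) = (√|x|)⁻¹ := fun x => by
    rw [Real.sqrt_eq_rpow, ← Real.rpow_neg (abs_nonneg _)]
    norm_num
  simpa [hF, e] using this

theorem norm_integral {a b : ℝ} (hab : a ≤ b) (h : HasConstPhase (Ioo a b) f g)
    (hg : ∀ x, 0 ≤ g x) : ‖∫ x in a..b, f x‖ = ∫ x in a..b, g x := by
  obtain ⟨c, hc, h⟩ := h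
  have : ∫ x in a..b, f x = ∫ x in a..b, c * (g x : ℂ) := by
    -- The end points, where factors may vanish and the phase is uncontrolled, form a null set.
    rw [intervalIntegral.integral_of_le hab, intervalIntegral.integral_of_le hab,
      integral_Ioc_eq_integral_Ioo, integral_Ioc_eq_integral_Ioo]
    exact setIntegral_congr_fun measurableSet_Ioo h
  rw [this, intervalIntegral.integral_const_mul, norm_mul, hc, one_mul,
    intervalIntegral.integral_ofReal, Complex.norm_real, Real.norm_eq_abs,
    abs_of_nonneg (intervalIntegral.integral_nonneg hab fun x _ => hg x)]

end HasConstPhase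

end Phase

/-- The absolute value of `varphi1` on the real axis. -/
noncomputable def absVarphi1 (α β τ x : ℝ) : ℝ :=
  √|x + α| * (√|x - β|)⁻¹ * (√|x ^ 2 - τ ^ 2|)⁻¹ * (√|x ^ 2 + 4|)⁻¹

/-- The absolute value of `varphi2` on the real axis. -/
noncomputable def absVarphi2 (α β τ x : ℝ) : ℝ :=
  (√|x + α|)⁻¹ * √|x - β| * (√|x ^ 2 - τ ^ 2|)⁻¹ * (√|x ^ 2 + 4|)⁻¹

/-- The absolute value of `phi1` on the real axis. -/
noncomputable def absPhi1 (a b t x : ℝ) : ℝ :=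
  √|x + a| * (√|x + 1 / b|)⁻¹ * √|x - 1 / a| * (√|x - b|)⁻¹ /
    (√|x + t| * √|x + 1 / t| * √|x - 1 / t| * √|x - t|)

/-- The absolute value of `phi2` on the real axis. -/
noncomputable def absPhi2 (a b t x : ℝ) : ℝ :=
  (√|x + a|)⁻¹ * √|x + 1 / b| * (√|x - 1 / a|)⁻¹ * √|x - b| /
    (√|x + t| * √|x + 1 / t| * √|x - 1 / t| * √|x - t|)

/-! ### Edge lengths in the variable ζ. -/

section Varphi

variable {α β τ p q : ℝ}

/-- The hypotheses keep -α, β and ±τ out of the open interval, so no factor changes sign. -/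
theorem norm_integral_varphi1 (hpq : p ≤ q) (hp : -τ ≤ p) (hq : q ≤ τ)
    (hα : q ≤ -α ∨ -α ≤ p) (hβ : q ≤ β ∨ β ≤ p) :
    ‖∫ x in p..q, varphi1 α β τ (x : ℂ)‖ = ∫ x in p..q, absVarphi1 α β τ x := by
  refine HasConstPhase.norm_integral hpq (.neg (.mul (.mul (.mul
    (.cpow_half (fun x => by push_cast; rfl) ?_)
    (.cpow_neg_half (fun x => by push_cast; rfl) ?_))
    (.cpow_neg_half (fun x => by push_cast; rfl) ?_))
    (.cpow_neg_half (fun x => by push_cast; rfl) ?_))) fun x => by unfold absVarphi1; positivity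
  · exact hα.symm.imp (fun h x hx => by linarith [hx.1]) fun h x hx => by linarith [hx.2]
  · exact hβ.symm.imp (fun h x hx => by linarith [hx.1]) fun h x hx => by linarith [hx.2]
  · exact .inr fun x hx => by nlinarith [hx.1, hx.2]
  · exact .inl fun x _ => by positivity

theorem norm_integral_varphi2 (hpq : p ≤ q) (hp : -τ ≤ p) (hq : q ≤ τ)
    (hα : q ≤ -α ∨ -α ≤ p) (hβ : q ≤ β ∨ β ≤ p) :
    ‖∫ x in p..q, varphi2 α β τ (x : ℂ)‖ = ∫ x in p..q, absVarphi2 α β τ x := by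
  refine HasConstPhase.norm_integral hpq (.mul (.mul (.mul
    (.cpow_neg_half (fun x => by push_cast; rfl) ?_)
    (.cpow_half (fun x => by push_cast; rfl) ?_))
    (.cpow_neg_half (fun x => by push_cast; rfl) ?_))
    (.cpow_neg_half (fun x => by push_cast; rfl) ?_)) fun x => by unfold absVarphi2; positivity
  · exact hα.symm.imp (fun h x hx => by linarith [hx.1]) fun h x hx => by linarith [hx.2]
  · exact hβ.symm.imp (fun h x hx => by linarith [hx.1]) fun h x hx => by linarith [hx.2]
  · exact .inr fun x hx => by nlinarith [hx.1, hx.2]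
  · exact .inl fun x _ => by positivity

end Varphi

/-! ### Edge lengths in the variable z and the substitution ζ = z - 1/z. -/

section Phi

variable {a b t p q : ℝ}

theorem denom_hasConstPhase (hp : -t ≤ p) (hq : q ≤ -(1 / t)) (ht : 0 < 1 / t) :
    HasConstPhase (Ioo p q) (fun x : ℝ => denom t x)
      (fun x => √|x + t| * √|x + 1 / t| * √|x - 1 / t| * √|x - t|) := by
  have ht' : 0 < t := one_div_pos.1 ht
  refine .mul (.mul (.mul
    (.cpow_half (fun x => by push_cast; rfl) ?_)
    (.cpow_half (fun x => by push_cast; rfl) ?_))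
    (.cpow_half (fun x => by push_cast; rfl) ?_))
    (.cpow_half (fun x => by push_cast; rfl) ?_)
  · exact .inl fun x hx => by linarith [hx.1]
  · exact .inr fun x hx => by linarith [hx.2]
  · exact .inr fun x hx => by linarith [hx.2]
  · exact .inr fun x hx => by linarith [hx.2]

theorem norm_integral_phi1 (hpq : p ≤ q) (hp : -t ≤ p) (hq : q ≤ -(1 / t)) (ht : 0 < 1 / t)
    (ha : 0 < 1 / a) (hb : 0 < b) (hpa : q ≤ -a ∨ -a ≤ p)
    (hpb : q ≤ -(1 / b) ∨ -(1 / b) ≤ p) :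
    ‖∫ x in p..q, phi1 a b t (x : ℂ)‖ = ∫ x in p..q, absPhi1 a b t x := by
  refine HasConstPhase.norm_integral hpq (.neg (.div (.mul (.mul (.mul
    (.cpow_half (fun x => by push_cast; rfl) ?_)
    (.cpow_neg_half (fun x => by push_cast; rfl) ?_))
    (.cpow_half (fun x => by push_cast; rfl) ?_))
    (.cpow_neg_half (fun x => by push_cast; rfl) ?_)) (denom_hasConstPhase hp hq ht)))
    fun x => by unfold absPhi1; positivity
  · exact hpa.symm.imp (fun h x hx => by linarith [hx.1]) fun h x hx => by linarith [hx.2]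
  · exact hpb.symm.imp (fun h x hx => by linarith [hx.1]) fun h x hx => by linarith [hx.2]
  · exact .inr fun x hx => by linarith [hx.2]
  · exact .inr fun x hx => by linarith [hx.2]

theorem norm_integral_phi2 (hpq : p ≤ q) (hp : -t ≤ p) (hq : q ≤ -(1 / t)) (ht : 0 < 1 / t)
    (ha : 0 < 1 / a) (hb : 0 < b) (hpa : q ≤ -a ∨ -a ≤ p)
    (hpb : q ≤ -(1 / b) ∨ -(1 / b) ≤ p) :
    ‖∫ x in p..q, phi2 a b t (x : ℂ)‖ = ∫ x in p..q, absPhi2 a b t x := by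
  refine HasConstPhase.norm_integral hpq (.div (.mul (.mul (.mul
    (.cpow_neg_half (fun x => by push_cast; rfl) ?_)
    (.cpow_half (fun x => by push_cast; rfl) ?_))
    (.cpow_neg_half (fun x => by push_cast; rfl) ?_))
    (.cpow_half (fun x => by push_cast; rfl) ?_)) (denom_hasConstPhase hp hq ht))
    fun x => by unfold absPhi2; positivity
  · exact hpa.symm.imp (fun h x hx => by linarith [hx.1]) fun h x hx => by linarith [hx.2]
  · exact hpb.symm.imp (fun h x hx => by linarith [hx.1]) fun h x hx => by linarith [hx.2]
  · exact .inr fun x hx => by linarith [hx.2]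
  · exact .inr fun x hx => by linarith [hx.2]

/-- The points a and -1/a have the same image under z ↦ z - 1/z, so the difference of images is (z -
a)(z + 1/a)/z. -/
theorem sqrt_abs_sub_one_div_sub {a z : ℝ} (hz : z ≠ 0) (ha : a ≠ 0) :
    √|z - 1 / z - (a - 1 / a)| = √|z - a| * √|z + 1 / a| / √|z| := by
  rw [← Real.sqrt_mul (abs_nonneg _), ← Real.sqrt_div (by positivity), ← abs_mul, ← abs_div]
  congr 2
  field_simp
  ring

theorem sqrt_abs_sub_one_div_add {a z : ℝ} (hz : z ≠ 0) (ha : a ≠ 0) :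
    √|z - 1 / z + (a - 1 / a)| = √|z + a| * √|z - 1 / a| / √|z| := by
  have := sqrt_abs_sub_one_div_sub (a := -a) hz (neg_ne_zero.2 ha)
  rw [sub_neg_eq_add, one_div_neg_eq_neg_one_div, ← sub_eq_add_neg] at this
  rw [← this]
  congr 2
  ring

theorem sqrt_abs_sq_sub_sq {t z : ℝ} (hz : z ≠ 0) (ht : t ≠ 0) :
    √|(z - 1 / z) ^ 2 - (t - 1 / t) ^ 2| =
      √|z + t| * √|z + 1 / t| * √|z - 1 / t| * √|z - t| / |z| := by
  rw [sq_sub_sq, abs_mul, Real.sqrt_mul (abs_nonneg _), sqrt_abs_sub_one_div_sub hz ht,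
    sqrt_abs_sub_one_div_add hz ht, div_mul_div_comm, Real.mul_self_sqrt (abs_nonneg z)]
  ring

/-- (z - 1/z)² + 4 = (z + 1/z)² is a perfect square; its root is |z| times the Jacobian 1 + 1/z². -/
theorem sqrt_abs_sq_add_four {z : ℝ} (hz : z ≠ 0) :
    √|(z - 1 / z) ^ 2 + 4| = |z| * (1 + 1 / z ^ 2) := by
  rw [show |(z - 1 / z) ^ 2 + 4| = (|z| * (1 + 1 / z ^ 2)) ^ 2 by
    rw [abs_of_pos (by positivity), mul_pow, sq_abs]; field_simp; ring]
  exact Real.sqrt_sq (by positivity)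

theorem absVarphi1_sub_one_div {z : ℝ} (hz : z ≠ 0) (ha : a ≠ 0) (hb : b ≠ 0) (ht : t ≠ 0) :
    absVarphi1 (a - 1 / a) (b - 1 / b) (t - 1 / t) (z - 1 / z) * (1 + 1 / z ^ 2) =
      absPhi1 a b t z := by
  have h1 : (1 + 1 / z ^ 2) ≠ 0 := by positivity
  have h2 : √|z| ≠ 0 := by positivity
  rw [absVarphi1, sqrt_abs_sub_one_div_add hz ha, sqrt_abs_sub_one_div_sub hz hb,
    sqrt_abs_sq_sub_sq hz ht, sqrt_abs_sq_add_four hz]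
  have h3 : |z| ≠ 0 := by positivity
  calc _ = absPhi1 a b t z * ((1 + 1 / z ^ 2)⁻¹ * (1 + 1 / z ^ 2)) * ((√|z|)⁻¹ * √|z|) *
        (|z| * |z|⁻¹) := by
        rw [absPhi1]
        generalize 1 + 1 / z ^ 2 = w
        simp only [div_eq_mul_inv, mul_inv, inv_inv]
        ring
    _ = absPhi1 a b t z := by
        rw [inv_mul_cancel₀ h1, inv_mul_cancel₀ h2, mul_inv_cancel₀ h3, mul_one, mul_one, mul_one]

theorem absVarphi2_sub_one_div {z : ℝ} (hz : z ≠ 0) (ha : a ≠ 0) (hb : b ≠ 0) (ht : t ≠ 0) :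
    absVarphi2 (a - 1 / a) (b - 1 / b) (t - 1 / t) (z - 1 / z) * (1 + 1 / z ^ 2) =
      absPhi2 a b t z := by
  have h1 : (1 + 1 / z ^ 2) ≠ 0 := by positivity
  have h2 : √|z| ≠ 0 := by positivity
  rw [absVarphi2, sqrt_abs_sub_one_div_add hz ha, sqrt_abs_sub_one_div_sub hz hb,
    sqrt_abs_sq_sub_sq hz ht, sqrt_abs_sq_add_four hz]
  have h3 : |z| ≠ 0 := by positivity
  calc _ = absPhi2 a b t z * ((1 + 1 / z ^ 2)⁻¹ * (1 + 1 / z ^ 2)) * ((√|z|)⁻¹ * √|z|) *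
        (|z| * |z|⁻¹) := by
        rw [absPhi2]
        generalize 1 + 1 / z ^ 2 = w
        simp only [div_eq_mul_inv, mul_inv, inv_inv]
        ring
    _ = absPhi2 a b t z := by
        rw [inv_mul_cancel₀ h1, inv_mul_cancel₀ h2, mul_inv_cancel₀ h3, mul_one, mul_one, mul_one]

theorem hasDerivAt_sub_one_div {z : ℝ} (hz : z ≠ 0) :
    HasDerivAt (fun z : ℝ => z - 1 / z) (1 + 1 / z ^ 2) z := by
  have := (hasDerivAt_id z).sub (hasDerivAt_inv hz)
  simpa [one_div, sub_neg_eq_add] using! this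

/-- On the negative half line the map avoids its pole and has positive derivative 1 + 1/z². -/
theorem integral_sub_one_div {f : ℝ → ℝ} (hpq : p ≤ q) (hq : q < 0) :
    ∫ x in (p - 1 / p)..(q - 1 / q), f x = ∫ z in p..q, f (z - 1 / z) * (1 + 1 / z ^ 2) := by
  refine (intervalIntegral.integral_comp_mul_deriv_of_deriv_nonneg
    (f := fun z => z - 1 / z) ?_ ?_ ?_).symm
  · intro x hx
    rw [uIcc_of_le hpq] at hx
    exact (hasDerivAt_sub_one_div (by linarith [hx.2] : x < 0).ne).continuousAt.continuousWithinAt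
  · intro x hx
    rw [max_eq_right hpq] at hx
    exact hasDerivAt_sub_one_div (by linarith [hx.2] : x < 0).ne
  · intro x _
    positivity

end Phi

/-- The substitution `ζ = z - 1 / z` does not change the period quotient. -/
theorem Q_eq_simpleQ {a b t : ℝ} (ht : 0 < 1 / t) (hta : 1 / t < 1 / a) (hab : 1 / a < b)
    (hbt : b < t) : Q a b t = simpleQ (a - 1 / a) (b - 1 / b) (t - 1 / t) := by
  have ht0 : 0 < t := one_div_pos.1 ht
  have ha0 : 0 < a := one_div_pos.1 (ht.trans hta)
  have hb0 : 0 < b := (ht.trans hta).trans hab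
  have hat : a < t := (one_div_lt_one_div ht0 ha0).1 hta
  have hba : 1 / b < a := (one_div_lt ha0 hb0).1 hab
  have hbt' : 1 / t < 1 / b := (one_div_lt_one_div ht0 hb0).2 hbt
  have hb1 : 0 < 1 / b := ht.trans hbt'
  have hα : a - 1 / a < t - 1 / t := by linarith
  have hαβ : -(a - 1 / a) < b - 1 / b := by linarith
  have hβ : b - 1 / b < t - 1 / t := by linarith
  have key1 : ∀ p q, p ≤ q → q < 0 → ∫ x in (p - 1 / p)..(q - 1 / q),
      absVarphi1 (a - 1 / a) (b - 1 / b) (t - 1 / t) x = ∫ z in p..q, absPhi1 a b t z := by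
    intro p q hpq hq
    rw [integral_sub_one_div hpq hq]
    refine intervalIntegral.integral_congr fun z hz => ?_
    rw [uIcc_of_le hpq] at hz
    exact absVarphi1_sub_one_div (by linarith [hz.2] : z < 0).ne ha0.ne' hb0.ne' ht0.ne'
  have key2 : ∀ p q, p ≤ q → q < 0 → ∫ x in (p - 1 / p)..(q - 1 / q),
      absVarphi2 (a - 1 / a) (b - 1 / b) (t - 1 / t) x = ∫ z in p..q, absPhi2 a b t z := by
    intro p q hpq hq
    rw [integral_sub_one_div hpq hq]
    refine intervalIntegral.integral_congr fun z hz => ?_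
    rw [uIcc_of_le hpq] at hz
    exact absVarphi2_sub_one_div (by linarith [hz.2] : z < 0).ne ha0.ne' hb0.ne' ht0.ne'
  have e1 : -(t - 1 / t) = -t - 1 / -t := by rw [one_div_neg_eq_neg_one_div]; ring
  have e2 : -(a - 1 / a) = -a - 1 / -a := by rw [one_div_neg_eq_neg_one_div]; ring
  -- The preimages of β and τ on the negative half line are -1/b and -1/t, so v₁, …, v₄ go in order
  -- to -τ, -α, β, τ.
  have e3 : b - 1 / b = -(1 / b) - 1 / -(1 / b) := by
    rw [one_div_neg_eq_neg_one_div, one_div_one_div]; ring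
  have e4 : t - 1 / t = -(1 / t) - 1 / -(1 / t) := by
    rw [one_div_neg_eq_neg_one_div, one_div_one_div]; ring
  have I1 : edgeI a b t 1 = simpleI (a - 1 / a) (b - 1 / b) (t - 1 / t) 1 := by
    refine (norm_integral_phi1 (by linarith) le_rfl (by linarith) ht (by linarith) hb0
      (.inl le_rfl) (.inl (by linarith))).trans <|
      Eq.trans ?_ (norm_integral_varphi1 (by linarith) le_rfl (by linarith)
        (.inl le_rfl) (.inl hαβ.le)).symm
    rw [← key1 _ _ (by linarith) (by linarith), ← e1, ← e2]
  have I2 : edgeI a b t 2 = simpleI (a - 1 / a) (b - 1 / b) (t - 1 / t) 2 := by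
    refine (norm_integral_phi1 (by linarith) (by linarith) (by linarith) ht (by linarith) hb0
      (.inr le_rfl) (.inl le_rfl)).trans <|
      Eq.trans ?_ (norm_integral_varphi1 (by linarith) (by linarith) (by linarith)
        (.inr le_rfl) (.inl le_rfl)).symm
    rw [← key1 _ _ (by linarith) (by linarith), ← e2, ← e3]
  have I3 : edgeI a b t 3 = simpleI (a - 1 / a) (b - 1 / b) (t - 1 / t) 3 := by
    refine (norm_integral_phi1 (by linarith) (by linarith) le_rfl ht (by linarith) hb0
      (.inr (by linarith)) (.inr le_rfl)).trans <|
      Eq.trans ?_ (norm_integral_varphi1 (by linarith) (by linarith) le_rfl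
        (.inr hαβ.le) (.inr le_rfl)).symm
    rw [← key1 _ _ (by linarith) (by linarith), ← e3, ← e4]
  have J1 : edgeJ a b t 1 = simpleJ (a - 1 / a) (b - 1 / b) (t - 1 / t) 1 := by
    refine (norm_integral_phi2 (by linarith) le_rfl (by linarith) ht (by linarith) hb0
      (.inl le_rfl) (.inl (by linarith))).trans <|
      Eq.trans ?_ (norm_integral_varphi2 (by linarith) le_rfl (by linarith)
        (.inl le_rfl) (.inl hαβ.le)).symm
    rw [← key2 _ _ (by linarith) (by linarith), ← e1, ← e2]
  have J2 : edgeJ a b t 2 = simpleJ (a - 1 / a) (b - 1 / b) (t - 1 / t) 2 := by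
    refine (norm_integral_phi2 (by linarith) (by linarith) (by linarith) ht (by linarith) hb0
      (.inr le_rfl) (.inl le_rfl)).trans <|
      Eq.trans ?_ (norm_integral_varphi2 (by linarith) (by linarith) (by linarith)
        (.inr le_rfl) (.inl le_rfl)).symm
    rw [← key2 _ _ (by linarith) (by linarith), ← e2, ← e3]
  have J3 : edgeJ a b t 3 = simpleJ (a - 1 / a) (b - 1 / b) (t - 1 / t) 3 := by
    refine (norm_integral_phi2 (by linarith) (by linarith) le_rfl ht (by linarith) hb0
      (.inr (by linarith)) (.inr le_rfl)).trans <|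
      Eq.trans ?_ (norm_integral_varphi2 (by linarith) (by linarith) le_rfl
        (.inr hαβ.le) (.inr le_rfl)).symm
    rw [← key2 _ _ (by linarith) (by linarith), ← e3, ← e4]
  rw [Q, simpleQ, I1, I2, I3, J1, J2, J3]

/-! ### Desingularised integrals over a fixed interval, and the symmetry in α and β. -/

/-- The affine map taking `[-1, 1]` to `[p, q]`. -/
noncomputable def affineNode (p q s : ℝ) : ℝ := (p + q) / 2 + (q - p) / 2 * s

theorem affineNode_mem {p q s : ℝ} (hpq : p ≤ q) (hs : s ∈ Icc (-1 : ℝ) 1) :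
    affineNode p q s ∈ Icc p q := by
  unfold affineNode
  constructor <;> nlinarith [hs.1, hs.2]

/-- Under z = (p + q)/2 + (q - p)/2 · sin θ both √((z - p)(q - z)) and dz/dθ equal (q - p)/2 · cos
θ, so the inverse square root singularities at p and q cancel. -/
theorem integral_eq_integral_affineNode_sin {p q : ℝ} (hpq : p < q) {f g : ℝ → ℝ}
    (h : ∀ z ∈ Ioo p q, √((z - p) * (q - z)) * g z = f z) :
    ∫ z in p..q, g z = ∫ θ in -(Real.pi / 2)..Real.pi / 2, f (affineNode p q (Real.sin θ)) := by
  have hπ := Real.pi_pos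
  have hle : -(Real.pi / 2) ≤ Real.pi / 2 := by linarith
  have hd : ∀ θ, HasDerivAt (fun θ => affineNode p q (Real.sin θ))
      ((q - p) / 2 * Real.cos θ) θ := fun θ =>
    ((Real.hasDerivAt_sin θ).const_mul _).const_add _
  have key := intervalIntegral.integral_comp_mul_deriv_of_deriv_nonneg (g := g)
    (a := -(Real.pi / 2)) (b := Real.pi / 2) (fun θ _ => (hd θ).continuousAt.continuousWithinAt)
    (fun θ _ => hd θ) (fun θ hθ => by
      rw [min_eq_left hle, max_eq_right hle] at hθ
      have := Real.cos_pos_of_mem_Ioo hθ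
      have := sub_pos.2 hpq
      positivity)
  simp only [Real.sin_neg, Real.sin_pi_div_two] at key
  rw [show affineNode p q (-1) = p by unfold affineNode; ring,
    show affineNode p q 1 = q by unfold affineNode; ring] at key
  rw [← key, intervalIntegral.integral_of_le hle, intervalIntegral.integral_of_le hle,
    integral_Ioc_eq_integral_Ioo, integral_Ioc_eq_integral_Ioo]
  refine setIntegral_congr_fun measurableSet_Ioo fun θ hθ => ?_
  have hc := Real.cos_pos_of_mem_Ioo hθ
  have hsc := Real.sin_sq_add_cos_sq θ
  have hs1 : Real.sin θ < 1 := by nlinarith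
  have hs2 : -1 < Real.sin θ := by nlinarith
  have hpq' := sub_pos.2 hpq
  have hmem : affineNode p q (Real.sin θ) ∈ Ioo p q := by
    unfold affineNode
    constructor <;> nlinarith
  rw [← h _ hmem, show (affineNode p q (Real.sin θ) - p) * (q - affineNode p q (Real.sin θ)) =
    ((q - p) / 2 * Real.cos θ) ^ 2 by
      unfold affineNode; linear_combination -((q - p) / 2) ^ 2 * hsc, Real.sqrt_sq (by positivity)]
  exact mul_comm _ _

/-- The radicand of the side integrals. -/
noncomputable def sidePoly (τ q z : ℝ) : ℝ := (z + q) * ((z + τ) * (z ^ 2 + 4))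

/-- The radicand of the middle integral, in terms of the square of the variable. -/
noncomputable def midPoly (τ y : ℝ) : ℝ := (τ ^ 2 - y) * (4 + y)

theorem sidePoly_pos {p q τ z : ℝ} (hq : -q < p) (hτ : -τ < p) (hz : p ≤ z) :
    0 < sidePoly τ q z := by
  have h1 : 0 < z + q := by linarith
  have h2 : 0 < z + τ := by linarith
  unfold sidePoly
  positivity

theorem midPoly_pos {τ z : ℝ} (h1 : -τ < z) (h2 : z < τ) : 0 < midPoly τ (z ^ 2) := by
  have : 0 < τ ^ 2 - z ^ 2 := by nlinarith
  unfold midPoly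
  positivity

/-- The integral of `((ζ + q) / (ζ - p)) ^ (1 / 2) / ((τ ^ 2 - ζ ^ 2) (ζ ^ 2 + 4)) ^ (1 / 2)`
over `[p, τ]`. -/
noncomputable def sideA (p q τ : ℝ) : ℝ :=
  ∫ θ in -(Real.pi / 2)..Real.pi / 2, (affineNode p τ (Real.sin θ) + q) /
    √(sidePoly τ q (affineNode p τ (Real.sin θ)))

/-- The integral of `((ζ - p) / (ζ + q)) ^ (1 / 2) / ((τ ^ 2 - ζ ^ 2) (ζ ^ 2 + 4)) ^ (1 / 2)`
over `[p, τ]`. -/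
noncomputable def sideB (p q τ : ℝ) : ℝ :=
  ∫ θ in -(Real.pi / 2)..Real.pi / 2, (affineNode p τ (Real.sin θ) - p) /
    √(sidePoly τ q (affineNode p τ (Real.sin θ)))

/-- The integral of `((ζ - p) (ζ + q)) ^ (-1 / 2) / ((τ ^ 2 - ζ ^ 2) (ζ ^ 2 + 4)) ^ (1 / 2)`
over `[p, τ]`. -/
noncomputable def sideC (p q τ : ℝ) : ℝ :=
  ∫ θ in -(Real.pi / 2)..Real.pi / 2, 1 / √(sidePoly τ q (affineNode p τ (Real.sin θ)))

/-- The integral of `((ζ + α) / (β - ζ)) ^ (1 / 2) / ((τ ^ 2 - ζ ^ 2) (ζ ^ 2 + 4)) ^ (1 / 2)`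
over `[-α, β]`. -/
noncomputable def midI (α β τ : ℝ) : ℝ :=
  ∫ θ in -(Real.pi / 2)..Real.pi / 2, (affineNode (-α) β (Real.sin θ) + α) /
    √(midPoly τ (affineNode (-α) β (Real.sin θ) ^ 2))

theorem integral_absVarphi1_right {p q τ : ℝ} (hq : -q < p) (hτ : -τ < p) (hpτ : p < τ) :
    ∫ x in p..τ, absVarphi1 q p τ x = sideA p q τ := by
  refine integral_eq_integral_affineNode_sin hpτ (f := fun z => (z + q) / √(sidePoly τ q z))
    fun z hz => ?_
  have h1 : 0 < z - p := sub_pos.2 hz.1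
  have h2 : 0 < τ - z := sub_pos.2 hz.2
  have h3 : 0 < z + q := by linarith
  have h4 : 0 < z + τ := by linarith
  have h5 : 0 < z ^ 2 + 4 := by positivity
  rw [absVarphi1, abs_of_pos h1, abs_of_pos h3, abs_of_pos h5, abs_sub_comm, sq_sub_sq,
    abs_of_pos (by rw [add_comm]; positivity), sidePoly, Real.sqrt_mul h1.le,
    Real.sqrt_mul (by linarith), Real.sqrt_mul h3.le, Real.sqrt_mul h4.le, add_comm τ z]
  nth_rw 2 [← Real.mul_self_sqrt h3.le]
  have := Real.sqrt_pos.2 h1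
  have := Real.sqrt_pos.2 h2
  have := Real.sqrt_pos.2 h3
  have := Real.sqrt_pos.2 h4
  have := Real.sqrt_pos.2 h5
  field_simp

theorem integral_absVarphi2_right {p q τ : ℝ} (hq : -q < p) (hτ : -τ < p) (hpτ : p < τ) :
    ∫ x in p..τ, absVarphi2 q p τ x = sideB p q τ := by
  refine integral_eq_integral_affineNode_sin hpτ (f := fun z => (z - p) / √(sidePoly τ q z))
    fun z hz => ?_
  have h1 : 0 < z - p := sub_pos.2 hz.1
  have h2 : 0 < τ - z := sub_pos.2 hz.2
  have h3 : 0 < z + q := by linarith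
  have h4 : 0 < z + τ := by linarith
  have h5 : 0 < z ^ 2 + 4 := by positivity
  rw [absVarphi2, abs_of_pos h1, abs_of_pos h3, abs_of_pos h5, abs_sub_comm, sq_sub_sq,
    abs_of_pos (by rw [add_comm]; positivity), sidePoly, Real.sqrt_mul h1.le,
    Real.sqrt_mul (by linarith), Real.sqrt_mul h3.le, Real.sqrt_mul h4.le, add_comm τ z]
  nth_rw 3 [← Real.mul_self_sqrt h1.le]
  have := Real.sqrt_pos.2 h1
  have := Real.sqrt_pos.2 h2
  have := Real.sqrt_pos.2 h3
  have := Real.sqrt_pos.2 h4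
  have := Real.sqrt_pos.2 h5
  field_simp

theorem integral_absVarphi1_mid {α β τ : ℝ} (h1 : -τ < -α) (h2 : -α < β) (h3 : β < τ) :
    ∫ x in -α..β, absVarphi1 α β τ x = midI α β τ := by
  refine integral_eq_integral_affineNode_sin h2 (f := fun z => (z + α) / √(midPoly τ (z ^ 2)))
    fun z hz => ?_
  have h1 : 0 < z + α := by linarith [hz.1]
  have h2 : 0 < β - z := sub_pos.2 hz.2
  have h5 : 0 < z ^ 2 + 4 := by positivity
  have h6 : 0 < τ ^ 2 - z ^ 2 := by nlinarith
  rw [absVarphi1, abs_of_pos h1, abs_sub_comm z, abs_of_pos h2, abs_of_pos h5, abs_sub_comm,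
    abs_of_pos h6, midPoly, sub_neg_eq_add, Real.sqrt_mul h1.le, Real.sqrt_mul h6.le,
    add_comm 4]
  nth_rw 3 [← Real.mul_self_sqrt h1.le]
  have := Real.sqrt_pos.2 h1
  have := Real.sqrt_pos.2 h2
  have := Real.sqrt_pos.2 h5
  have := Real.sqrt_pos.2 h6
  field_simp

/-- The reflection symmetry behind the antisymmetry of Q: it moves the left side integral to the
right side. -/
theorem absVarphi1_neg (α β τ x : ℝ) : absVarphi1 α β τ (-x) = absVarphi2 β α τ x := by
  unfold absVarphi1 absVarphi2
  rw [neg_sq, ← abs_neg (-x + α), ← abs_neg (-x - β), neg_add, neg_neg, neg_sub,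
    sub_neg_eq_add, ← sub_eq_add_neg, add_comm β, mul_comm (√|x - α|)]

theorem absVarphi2_neg (α β τ x : ℝ) : absVarphi2 α β τ (-x) = absVarphi1 β α τ x := by
  rw [← absVarphi1_neg, neg_neg]

theorem integral_absVarphi1_neg (α β τ p q : ℝ) :
    ∫ x in -q..-p, absVarphi1 α β τ x = ∫ x in p..q, absVarphi2 β α τ x := by
  rw [← intervalIntegral.integral_comp_neg]
  simp only [absVarphi1_neg]

theorem integral_absVarphi2_neg (α β τ p q : ℝ) :
    ∫ x in -q..-p, absVarphi2 α β τ x = ∫ x in p..q, absVarphi1 β α τ x := by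
  rw [← intervalIntegral.integral_comp_neg]
  simp only [absVarphi2_neg]

/-- The subtracted quotient is the first one with α and β exchanged. -/
theorem simpleQ_eq {α β τ : ℝ} (h1 : -τ < -α) (h2 : -α < β) (h3 : β < τ) :
    simpleQ α β τ = (sideA β α τ + sideB α β τ) / midI α β τ -
      (sideA α β τ + sideB β α τ) / midI β α τ := by
  have I1 : simpleI α β τ 1 = sideB α β τ := by
    refine (norm_integral_varphi1 h1.le le_rfl (by linarith) (.inl le_rfl) (.inl h2.le)).trans ?_
    rw [integral_absVarphi1_neg, integral_absVarphi2_right (by linarith) (by linarith)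
      (by linarith)]
  have I2 : simpleI α β τ 2 = midI α β τ := by
    refine (norm_integral_varphi1 h2.le h1.le h3.le (.inr le_rfl) (.inl le_rfl)).trans ?_
    exact integral_absVarphi1_mid h1 h2 h3
  have I3 : simpleI α β τ 3 = sideA β α τ := by
    refine (norm_integral_varphi1 h3.le (by linarith) le_rfl (.inr h2.le) (.inr le_rfl)).trans ?_
    exact integral_absVarphi1_right h2 (by linarith) h3
  have J1 : simpleJ α β τ 1 = sideA α β τ := by
    refine (norm_integral_varphi2 h1.le le_rfl (by linarith) (.inl le_rfl) (.inl h2.le)).trans ?_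
    rw [integral_absVarphi2_neg, integral_absVarphi1_right (by linarith) (by linarith)
      (by linarith)]
  have J2 : simpleJ α β τ 2 = midI β α τ := by
    refine (norm_integral_varphi2 h2.le h1.le h3.le (.inr le_rfl) (.inl le_rfl)).trans ?_
    have := integral_absVarphi2_neg α β τ (-β) α
    rw [neg_neg] at this
    exact this.trans (integral_absVarphi1_mid (by linarith) (by linarith) (by linarith))
  have J3 : simpleJ α β τ 3 = sideB β α τ := by
    refine (norm_integral_varphi2 h3.le (by linarith) le_rfl (.inr h2.le) (.inr le_rfl)).trans ?_
    exact integral_absVarphi2_right h2 (by linarith) h3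
  rw [simpleQ, I1, I2, I3, J1, J2, J3, add_comm (sideB α β τ)]

/-- The period quotient vanishes on the diagonal. -/
theorem simpleQ_diag {α τ : ℝ} (h1 : 0 < α) (h2 : α < τ) : simpleQ α α τ = 0 := by
  rw [simpleQ_eq (by linarith) (by linarith) h2, sub_self]

/-- The divided difference of `sideC`. -/
noncomputable def sideDiff (α β τ : ℝ) : ℝ :=
  ∫ θ in -(Real.pi / 2)..Real.pi / 2,
    ((1 + Real.sin θ) / 2 * ((affineNode α τ (Real.sin θ) + τ) *
        (affineNode α τ (Real.sin θ) ^ 2 + 4)) -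
      (affineNode β τ (Real.sin θ) + α) * ((1 - Real.sin θ) / 2) *
        (affineNode β τ (Real.sin θ) ^ 2 +
          affineNode β τ (Real.sin θ) * affineNode α τ (Real.sin θ) +
          affineNode α τ (Real.sin θ) ^ 2 +
          τ * (affineNode β τ (Real.sin θ) + affineNode α τ (Real.sin θ)) + 4)) /
      (√(sidePoly τ α (affineNode β τ (Real.sin θ))) *
        √(sidePoly τ β (affineNode α τ (Real.sin θ))) *
        (√(sidePoly τ α (affineNode β τ (Real.sin θ))) +
          √(sidePoly τ β (affineNode α τ (Real.sin θ)))))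

/-- The divided difference of `midI`. -/
noncomputable def midDiff (α β τ : ℝ) : ℝ :=
  ∫ θ in -(Real.pi / 2)..Real.pi / 2,
    (α + β) / 2 * (1 + Real.sin θ) * (-(α + β) * Real.sin θ *
      (τ ^ 2 - 4 - affineNode (-α) β (Real.sin θ) ^ 2 - affineNode (-β) α (Real.sin θ) ^ 2)) /
      (√(midPoly τ (affineNode (-α) β (Real.sin θ) ^ 2)) *
        √(midPoly τ (affineNode (-β) α (Real.sin θ) ^ 2)) *
        (√(midPoly τ (affineNode (-α) β (Real.sin θ) ^ 2)) +
          √(midPoly τ (affineNode (-β) α (Real.sin θ) ^ 2))))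

/-! ### Analyticity of the integrands and of the divided differences. -/

section Analytic

variable {E : Type*} [NormedAddCommGroup E] [NormedSpace ℝ E] {x₀ : E} {f g t : E → ℝ} {a b : ℝ}

theorem unifAnalyticAt_affineNode (hf : AnalyticAt ℝ f x₀) (hg : AnalyticAt ℝ g x₀) :
    UnifAnalyticAt a b (fun x θ => affineNode (f x) (g x) (Real.sin θ)) x₀ := by
  unfold affineNode
  exact (UnifAnalyticAt.of_analyticAt (by fun_prop (disch := norm_num))).add
    ((UnifAnalyticAt.of_analyticAt (by fun_prop (disch := norm_num))).mul
      (.of_continuous Real.continuous_sin))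

theorem unifAnalyticAt_sidePoly (hf : AnalyticAt ℝ f x₀) (hg : AnalyticAt ℝ g x₀)
    (ht : AnalyticAt ℝ t x₀) :
    UnifAnalyticAt a b
      (fun x θ => sidePoly (t x) (g x) (affineNode (f x) (t x) (Real.sin θ))) x₀ := by
  have hn := unifAnalyticAt_affineNode (a := a) (b := b) hf ht
  unfold sidePoly
  exact (hn.add (.of_analyticAt hg)).mul
    ((hn.add (.of_analyticAt ht)).mul ((hn.pow 2).add (.const 4)))

theorem unifAnalyticAt_midPoly (hf : AnalyticAt ℝ f x₀) (hg : AnalyticAt ℝ g x₀)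
    (ht : AnalyticAt ℝ t x₀) :
    UnifAnalyticAt a b
      (fun x θ => midPoly (t x) (affineNode (-f x) (g x) (Real.sin θ) ^ 2)) x₀ := by
  have hn := unifAnalyticAt_affineNode (a := a) (b := b) hf.neg hg
  unfold midPoly
  exact ((UnifAnalyticAt.of_analyticAt (ht.pow 2)).sub (hn.pow 2)).mul
    ((UnifAnalyticAt.const 4).add (hn.pow 2))

theorem sidePoly_affineNode_pos {p q τ : ℝ} (hq : -q < p) (hτ : -τ < p) (hpτ : p < τ) (θ : ℝ) :
    0 < sidePoly τ q (affineNode p τ (Real.sin θ)) :=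
  sidePoly_pos hq hτ (affineNode_mem hpτ.le (Real.sin_mem_Icc θ)).1

theorem midPoly_affineNode_pos {α β τ : ℝ} (h1 : -τ < -α) (h2 : -α < β) (h3 : β < τ) (θ : ℝ) :
    0 < midPoly τ (affineNode (-α) β (Real.sin θ) ^ 2) := by
  have := affineNode_mem h2.le (Real.sin_mem_Icc θ)
  exact midPoly_pos (h1.trans_le this.1) (this.2.trans_lt h3)

theorem neg_pi_div_two_le_pi_div_two : -(Real.pi / 2) ≤ Real.pi / 2 := by
  linarith [Real.pi_pos]

theorem unifAnalyticAt_sideA (hf : AnalyticAt ℝ f x₀) (hg : AnalyticAt ℝ g x₀)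
    (ht : AnalyticAt ℝ t x₀) (h1 : -g x₀ < f x₀) (h2 : -t x₀ < f x₀) (h3 : f x₀ < t x₀) :
    UnifAnalyticAt a b (fun x θ => (affineNode (f x) (t x) (Real.sin θ) + g x) /
      √(sidePoly (t x) (g x) (affineNode (f x) (t x) (Real.sin θ)))) x₀ :=
  ((unifAnalyticAt_affineNode hf ht).add (.of_analyticAt hg)).div
    ((unifAnalyticAt_sidePoly hf hg ht).sqrt fun θ _ => sidePoly_affineNode_pos h1 h2 h3 θ)
    fun θ _ => (Real.sqrt_pos.2 (sidePoly_affineNode_pos h1 h2 h3 θ)).ne'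

theorem unifAnalyticAt_sideB (hf : AnalyticAt ℝ f x₀) (hg : AnalyticAt ℝ g x₀)
    (ht : AnalyticAt ℝ t x₀) (h1 : -g x₀ < f x₀) (h2 : -t x₀ < f x₀) (h3 : f x₀ < t x₀) :
    UnifAnalyticAt a b (fun x θ => (affineNode (f x) (t x) (Real.sin θ) - f x) /
      √(sidePoly (t x) (g x) (affineNode (f x) (t x) (Real.sin θ)))) x₀ :=
  ((unifAnalyticAt_affineNode hf ht).sub (.of_analyticAt hf)).div
    ((unifAnalyticAt_sidePoly hf hg ht).sqrt fun θ _ => sidePoly_affineNode_pos h1 h2 h3 θ)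
    fun θ _ => (Real.sqrt_pos.2 (sidePoly_affineNode_pos h1 h2 h3 θ)).ne'

theorem unifAnalyticAt_sideC (hf : AnalyticAt ℝ f x₀) (hg : AnalyticAt ℝ g x₀)
    (ht : AnalyticAt ℝ t x₀) (h1 : -g x₀ < f x₀) (h2 : -t x₀ < f x₀) (h3 : f x₀ < t x₀) :
    UnifAnalyticAt a b (fun x θ => 1 /
      √(sidePoly (t x) (g x) (affineNode (f x) (t x) (Real.sin θ)))) x₀ :=
  (UnifAnalyticAt.const 1).div
    ((unifAnalyticAt_sidePoly hf hg ht).sqrt fun θ _ => sidePoly_affineNode_pos h1 h2 h3 θ)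
    fun θ _ => (Real.sqrt_pos.2 (sidePoly_affineNode_pos h1 h2 h3 θ)).ne'

theorem unifAnalyticAt_midI (hf : AnalyticAt ℝ f x₀) (hg : AnalyticAt ℝ g x₀)
    (ht : AnalyticAt ℝ t x₀) (h1 : -t x₀ < -f x₀) (h2 : -f x₀ < g x₀) (h3 : g x₀ < t x₀) :
    UnifAnalyticAt a b (fun x θ => (affineNode (-f x) (g x) (Real.sin θ) + f x) /
      √(midPoly (t x) (affineNode (-f x) (g x) (Real.sin θ) ^ 2))) x₀ :=
  ((unifAnalyticAt_affineNode hf.neg hg).add (.of_analyticAt hf)).div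
    ((unifAnalyticAt_midPoly hf hg ht).sqrt fun θ _ => midPoly_affineNode_pos h1 h2 h3 θ)
    fun θ _ => (Real.sqrt_pos.2 (midPoly_affineNode_pos h1 h2 h3 θ)).ne'

theorem analyticAt_sideDiff (hf : AnalyticAt ℝ f x₀) (hg : AnalyticAt ℝ g x₀)
    (ht : AnalyticAt ℝ t x₀) (h1 : -t x₀ < -f x₀) (h2 : -f x₀ < g x₀) (h3 : g x₀ < t x₀) :
    AnalyticAt ℝ (fun x => sideDiff (f x) (g x) (t x)) x₀ := by
  have p1 : ∀ θ : ℝ, 0 < √(sidePoly (t x₀) (f x₀) (affineNode (g x₀) (t x₀) (Real.sin θ))) :=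
    fun θ => Real.sqrt_pos.2 (sidePoly_affineNode_pos h2 (by linarith) h3 θ)
  have p2 : ∀ θ : ℝ, 0 < √(sidePoly (t x₀) (g x₀) (affineNode (f x₀) (t x₀) (Real.sin θ))) :=
    fun θ => Real.sqrt_pos.2
      (sidePoly_affineNode_pos (by linarith) (by linarith) (by linarith) θ)
  refine UnifAnalyticAt.analyticAt_integral neg_pi_div_two_le_pi_div_two ?_
  have n1 := unifAnalyticAt_affineNode (a := -(Real.pi / 2)) (b := Real.pi / 2) hg ht
  have n2 := unifAnalyticAt_affineNode (a := -(Real.pi / 2)) (b := Real.pi / 2) hf ht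
  have u1 := (unifAnalyticAt_sidePoly (a := -(Real.pi / 2)) (b := Real.pi / 2) hg hf ht).sqrt
    fun θ _ => Real.sqrt_pos.1 (p1 θ)
  have u2 := (unifAnalyticAt_sidePoly (a := -(Real.pi / 2)) (b := Real.pi / 2) hf hg ht).sqrt
    fun θ _ => Real.sqrt_pos.1 (p2 θ)
  have T := UnifAnalyticAt.of_analyticAt (a := -(Real.pi / 2)) (b := Real.pi / 2) ht
  refine .div (.sub (.mul (.of_continuous (by fun_prop)) (.mul (n2.add T)
    ((n2.pow 2).add (.const 4)))) (.mul (.mul (n1.add (.of_analyticAt hf))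
    (.of_continuous (by fun_prop))) (((((n1.pow 2).add (n1.mul n2)).add (n2.pow 2)).add
    (T.mul (n1.add n2))).add (.const 4)))) ((u1.mul u2).mul (u1.add u2)) fun θ _ => ?_
  have := p1 θ
  have := p2 θ
  positivity

theorem analyticAt_midDiff (hf : AnalyticAt ℝ f x₀) (hg : AnalyticAt ℝ g x₀)
    (ht : AnalyticAt ℝ t x₀) (h1 : -t x₀ < -f x₀) (h2 : -f x₀ < g x₀) (h3 : g x₀ < t x₀) :
    AnalyticAt ℝ (fun x => midDiff (f x) (g x) (t x)) x₀ := by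
  have p1 : ∀ θ : ℝ, 0 < √(midPoly (t x₀) (affineNode (-f x₀) (g x₀) (Real.sin θ) ^ 2)) :=
    fun θ => Real.sqrt_pos.2 (midPoly_affineNode_pos h1 h2 h3 θ)
  have p2 : ∀ θ : ℝ, 0 < √(midPoly (t x₀) (affineNode (-g x₀) (f x₀) (Real.sin θ) ^ 2)) :=
    fun θ => Real.sqrt_pos.2
      (midPoly_affineNode_pos (by linarith) (by linarith) (by linarith) θ)
  refine UnifAnalyticAt.analyticAt_integral neg_pi_div_two_le_pi_div_two ?_
  have n1 := unifAnalyticAt_affineNode (a := -(Real.pi / 2)) (b := Real.pi / 2) hf.neg hg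
  have n2 := unifAnalyticAt_affineNode (a := -(Real.pi / 2)) (b := Real.pi / 2) hg.neg hf
  have u1 := (unifAnalyticAt_midPoly (a := -(Real.pi / 2)) (b := Real.pi / 2) hf hg ht).sqrt
    fun θ _ => Real.sqrt_pos.1 (p1 θ)
  have u2 := (unifAnalyticAt_midPoly (a := -(Real.pi / 2)) (b := Real.pi / 2) hg hf ht).sqrt
    fun θ _ => Real.sqrt_pos.1 (p2 θ)
  refine .div (.mul (.mul (.of_analyticAt (by fun_prop (disch := norm_num)))
    (.of_continuous (by fun_prop))) (.mul (.mul (.of_analyticAt (by fun_prop))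
    (.of_continuous (by fun_prop))) (.sub (.sub (.of_analyticAt (by fun_prop)) (n1.pow 2))
    (n2.pow 2)))) ((u1.mul u2).mul (u1.add u2)) fun θ _ => ?_
  have := p1 θ
  have := p2 θ
  positivity

end Analytic

/-! ### Divisibility of Q by β - α. -/

theorem one_div_sqrt_sub_one_div_sqrt {u v : ℝ} (hu : 0 < u) (hv : 0 < v) :
    1 / √u - 1 / √v = (v - u) / (√u * √v * (√u + √v)) := by
  have hu' := Real.sqrt_pos.2 hu
  have hv' := Real.sqrt_pos.2 hv
  have hd : v - u = (√u + √v) * (√v - √u) := by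
    linear_combination Real.sq_sqrt hu.le - Real.sq_sqrt hv.le
  rw [hd]
  field_simp

theorem midI_pos {α β τ : ℝ} (h1 : -τ < -α) (h2 : -α < β) (h3 : β < τ) : 0 < midI α β τ := by
  -- Uniform analyticity in a dummy real parameter is used here only for integrability.
  refine intervalIntegral.intervalIntegral_pos_of_pos_on
    ((unifAnalyticAt_midI (x₀ := (0 : ℝ)) (f := fun _ => α) (g := fun _ => β) (t := fun _ => τ)
      analyticAt_const analyticAt_const analyticAt_const h1 h2 h3).intervalIntegrable
      neg_pi_div_two_le_pi_div_two) (fun θ hθ => ?_) (by linarith [Real.pi_pos])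
  have hc := Real.cos_pos_of_mem_Ioo hθ
  have hs : -1 < Real.sin θ := by nlinarith [Real.sin_sq_add_cos_sq θ]
  refine div_pos ?_ (Real.sqrt_pos.2 (midPoly_affineNode_pos h1 h2 h3 θ))
  unfold affineNode
  nlinarith

/-- (z + q) - (z - p) = p + q. Thus the antisymmetric part of the side integrals involves only
`sideC`. -/
theorem sideA_sub_sideB {p q τ : ℝ} (h1 : -q < p) (h2 : -τ < p) (h3 : p < τ) :
    sideA p q τ - sideB p q τ = (p + q) * sideC p q τ := by
  have hA := (unifAnalyticAt_sideA (x₀ := (0 : ℝ)) (f := fun _ => p) (g := fun _ => q)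
    (t := fun _ => τ) analyticAt_const analyticAt_const analyticAt_const h1 h2
    h3).intervalIntegrable neg_pi_div_two_le_pi_div_two
  have hB := (unifAnalyticAt_sideB (x₀ := (0 : ℝ)) (f := fun _ => p) (g := fun _ => q)
    (t := fun _ => τ) analyticAt_const analyticAt_const analyticAt_const h1 h2
    h3).intervalIntegrable neg_pi_div_two_le_pi_div_two
  rw [sideA, sideB, sideC, ← intervalIntegral.integral_const_mul,
    ← intervalIntegral.integral_sub hA hB]
  refine intervalIntegral.integral_congr fun θ _ => ?_
  ring

/-- At equal θ, with s = sin θ, the nodes z_β and z_α differ by (β - α)(1 - s)/2 while (z_α + β) -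
(z_β + α) = (β - α)(1 + s)/2. Both changes in the radicand therefore carry the factor β - α. -/
theorem sideC_sub_sideC {α β τ : ℝ} (h1 : -τ < -α) (h2 : -α < β) (h3 : β < τ) :
    sideC β α τ - sideC α β τ = (β - α) * sideDiff α β τ := by
  have hC1 := (unifAnalyticAt_sideC (x₀ := (0 : ℝ)) (f := fun _ => β) (g := fun _ => α)
    (t := fun _ => τ) analyticAt_const analyticAt_const analyticAt_const h2 (by linarith)
    h3).intervalIntegrable neg_pi_div_two_le_pi_div_two
  have hC2 := (unifAnalyticAt_sideC (x₀ := (0 : ℝ)) (f := fun _ => α) (g := fun _ => β)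
    (t := fun _ => τ) analyticAt_const analyticAt_const analyticAt_const (by linarith)
    (by linarith) (by linarith)).intervalIntegrable neg_pi_div_two_le_pi_div_two
  rw [sideC, sideC, sideDiff, ← intervalIntegral.integral_const_mul,
    ← intervalIntegral.integral_sub hC1 hC2]
  refine intervalIntegral.integral_congr fun θ _ => ?_
  rw [one_div_sqrt_sub_one_div_sqrt (sidePoly_affineNode_pos h2 (by linarith) h3 θ)
    (sidePoly_affineNode_pos (by linarith) (by linarith) (by linarith) θ), ← mul_div_assoc]
  congr 1
  unfold sidePoly affineNode
  ring

/-- At equal θ the two numerators coincide, and the squares of the nodes differ by (β - α)(α + β)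
sin θ. -/
theorem midI_sub_midI {α β τ : ℝ} (h1 : -τ < -α) (h2 : -α < β) (h3 : β < τ) :
    midI α β τ - midI β α τ = (β - α) * midDiff α β τ := by
  have hI := (unifAnalyticAt_midI (x₀ := (0 : ℝ)) (f := fun _ => α) (g := fun _ => β)
    (t := fun _ => τ) analyticAt_const analyticAt_const analyticAt_const h1 h2
    h3).intervalIntegrable neg_pi_div_two_le_pi_div_two
  have hJ := (unifAnalyticAt_midI (x₀ := (0 : ℝ)) (f := fun _ => β) (g := fun _ => α)
    (t := fun _ => τ) analyticAt_const analyticAt_const analyticAt_const (by linarith)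
    (by linarith) (by linarith)).intervalIntegrable neg_pi_div_two_le_pi_div_two
  rw [midI, midI, midDiff, ← intervalIntegral.integral_const_mul,
    ← intervalIntegral.integral_sub hI hJ]
  refine intervalIntegral.integral_congr fun θ _ => ?_
  have e1 : affineNode (-α) β (Real.sin θ) + α = (α + β) / 2 * (1 + Real.sin θ) := by
    unfold affineNode; ring
  have e2 : affineNode (-β) α (Real.sin θ) + β = (α + β) / 2 * (1 + Real.sin θ) := by
    unfold affineNode; ring
  rw [e1, e2, div_eq_mul_one_div, div_eq_mul_one_div (_ * _) √(midPoly τ (affineNode (-β) α _ ^ 2)),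
    ← mul_sub, one_div_sqrt_sub_one_div_sqrt (midPoly_affineNode_pos h1 h2 h3 θ)
    (midPoly_affineNode_pos (by linarith) (by linarith) (by linarith) θ), ← mul_div_assoc,
    ← mul_div_assoc]
  congr 1
  unfold midPoly affineNode
  ring

/-- The analytic extension of `Q / (β - α)`. -/
noncomputable def quotQ (p : ℝ × ℝ × ℝ) : ℝ :=
  ((p.1 + p.2.1) * sideDiff p.1 p.2.1 p.2.2 * midI p.2.1 p.1 p.2.2 -
    (sideA p.1 p.2.1 p.2.2 + sideB p.2.1 p.1 p.2.2) * midDiff p.1 p.2.1 p.2.2) /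
    (midI p.1 p.2.1 p.2.2 * midI p.2.1 p.1 p.2.2)

theorem simpleQ_eq_mul_quotQ {α β τ : ℝ} (h1 : -τ < -α) (h2 : -α < β) (h3 : β < τ) :
    simpleQ α β τ = (β - α) * quotQ (α, β, τ) := by
  have hI := midI_pos h1 h2 h3
  have hJ := midI_pos (α := β) (β := α) (τ := τ) (by linarith) (by linarith) (by linarith)
  have e1 := sideA_sub_sideB h2 (by linarith) h3
  have e2 := sideA_sub_sideB (p := α) (q := β) (τ := τ) (by linarith) (by linarith) (by linarith)
  have e3 := sideC_sub_sideC h1 h2 h3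
  have e4 := midI_sub_midI h1 h2 h3
  rw [simpleQ_eq h1 h2 h3, quotQ, div_sub_div _ _ hI.ne' hJ.ne', ← mul_div_assoc]
  congr 1
  -- With quotients N/I and N'/I', use N I' - N' I = (N - N') I' - N' (I - I'); here N - N' = (α +
  -- β) times the difference of the two `sideC`.
  linear_combination midI β α τ * (e1 - e2) + (α + β) * midI β α τ * e3 -
    (sideA α β τ + sideB β α τ) * e4

theorem analyticOnNhd_quotQ : AnalyticOnNhd ℝ quotQ simpleDomain := by
  rintro x₀ ⟨h1, h2, h3⟩
  have ha : AnalyticAt ℝ (fun p : ℝ × ℝ × ℝ => p.1) x₀ := analyticAt_fst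
  have hb : AnalyticAt ℝ (fun p : ℝ × ℝ × ℝ => p.2.1) x₀ :=
    analyticAt_fst.comp analyticAt_snd
  have ht : AnalyticAt ℝ (fun p : ℝ × ℝ × ℝ => p.2.2) x₀ :=
    analyticAt_snd.comp analyticAt_snd
  have hI : AnalyticAt ℝ (fun p : ℝ × ℝ × ℝ => midI p.1 p.2.1 p.2.2) x₀ :=
    (unifAnalyticAt_midI ha hb ht h1 h2 h3).analyticAt_integral neg_pi_div_two_le_pi_div_two
  have hJ : AnalyticAt ℝ (fun p : ℝ × ℝ × ℝ => midI p.2.1 p.1 p.2.2) x₀ :=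
    (unifAnalyticAt_midI hb ha ht (by linarith) (by linarith)
      (by linarith)).analyticAt_integral neg_pi_div_two_le_pi_div_two
  have hA : AnalyticAt ℝ (fun p : ℝ × ℝ × ℝ => sideA p.1 p.2.1 p.2.2) x₀ :=
    (unifAnalyticAt_sideA ha hb ht (by linarith) (by linarith)
      (by linarith)).analyticAt_integral neg_pi_div_two_le_pi_div_two
  have hB : AnalyticAt ℝ (fun p : ℝ × ℝ × ℝ => sideB p.2.1 p.1 p.2.2) x₀ :=
    (unifAnalyticAt_sideB hb ha ht (by linarith) (by linarith)
      (by linarith)).analyticAt_integral neg_pi_div_two_le_pi_div_two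
  refine AnalyticAt.div (.sub (.mul (.mul (ha.add hb) (analyticAt_sideDiff ha hb ht h1 h2 h3)) hJ)
    (.mul (hA.add hB) (analyticAt_midDiff ha hb ht h1 h2 h3))) (hI.mul hJ) (mul_ne_zero ?_ ?_)
  · exact (midI_pos h1 h2 h3).ne'
  · exact (midI_pos (by linarith) (by linarith) (by linarith)).ne'

theorem intervalIntegral_eq_zero_of_odd {f : ℝ → ℝ} (hf : ∀ x, f (-x) = -f x) (c : ℝ) :
    ∫ x in -c..c, f x = 0 := by
  have h := intervalIntegral.integral_comp_neg (a := -c) (b := c) f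
  simp only [hf, intervalIntegral.integral_neg, neg_neg] at h
  linarith

theorem intervalIntegral_eq_two_mul_of_even {f : ℝ → ℝ} (hf : ∀ x, f (-x) = f x)
    (hc : Continuous f) (c : ℝ) : ∫ x in -c..c, f x = 2 * ∫ x in 0..c, f x := by
  have h := intervalIntegral.integral_comp_neg (a := -c) (b := 0) f
  simp only [hf, neg_neg, neg_zero] at h
  rw [← intervalIntegral.integral_add_adjacent_intervals (hc.intervalIntegrable (-c) 0)
    (hc.intervalIntegrable 0 c), h]
  ring

/-! ### Complete elliptic integrals: derivative and monotonicity. -/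

section Elliptic

variable {m : ℝ}

theorem one_sub_mul_sin_sq_pos (hm : m < 1) (θ : ℝ) : 0 < 1 - m * Real.sin θ ^ 2 := by
  have h1 := Real.sin_sq_add_cos_sq θ
  have h2 := sq_nonneg (Real.cos θ)
  have h3 := sq_nonneg (Real.sin θ)
  rcases h3.eq_or_lt with h | h
  · rw [← h]; norm_num
  · nlinarith

theorem unifAnalyticAt_one_sub_mul_sin_sq {a b : ℝ} (m₀ : ℝ) :
    UnifAnalyticAt a b (fun m θ => 1 - m * Real.sin θ ^ 2) m₀ :=
  (UnifAnalyticAt.const 1).sub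
    ((UnifAnalyticAt.of_analyticAt analyticAt_id).mul (.of_continuous (by fun_prop)))

/-- The function m sin θ cos θ / √(1 - m sin² θ) vanishes at 0 and π/2; its derivative combines the
integrands of E, K and the left side. The left side is the formal derivative of K in m. -/
theorem integral_sin_sq_div_eq_ellipticE_sub_ellipticK (hm0 : 0 < m) (hm : m < 1) :
    ∫ θ in (0 : ℝ)..(Real.pi / 2), 1 / 2 * Real.sin θ ^ 2 /
        ((1 - m * Real.sin θ ^ 2) * √(1 - m * Real.sin θ ^ 2)) =
      (ellipticE m - (1 - m) * ellipticK m) / (2 * m * (1 - m)) := by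
  have hpos := one_sub_mul_sin_sq_pos hm
  have hspos : ∀ θ, 0 < √(1 - m * Real.sin θ ^ 2) := fun θ => Real.sqrt_pos.2 (hpos θ)
  have hcE : Continuous fun θ => √(1 - m * Real.sin θ ^ 2) := by fun_prop
  have hcK : Continuous fun θ => 1 / √(1 - m * Real.sin θ ^ 2) :=
    continuous_const.div hcE fun θ => (hspos θ).ne'
  have hcD : Continuous fun θ => 1 / 2 * Real.sin θ ^ 2 /
      ((1 - m * Real.sin θ ^ 2) * √(1 - m * Real.sin θ ^ 2)) :=
    Continuous.div (by fun_prop) (by fun_prop) fun θ => (mul_pos (hpos θ) (hspos θ)).ne'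
  have hd : ∀ θ, HasDerivAt (fun θ => m * (Real.sin θ * Real.cos θ / √(1 - m * Real.sin θ ^ 2)))
      (√(1 - m * Real.sin θ ^ 2) - (1 - m) * (1 / √(1 - m * Real.sin θ ^ 2)) -
        2 * m * (1 - m) * (1 / 2 * Real.sin θ ^ 2 /
          ((1 - m * Real.sin θ ^ 2) * √(1 - m * Real.sin θ ^ 2)))) θ := fun θ => by
    have h1 : HasDerivAt (fun θ => 1 - m * Real.sin θ ^ 2)
        (-(m * (2 * Real.sin θ * Real.cos θ))) θ := by
      simpa using (((Real.hasDerivAt_sin θ).pow 2).const_mul m).const_sub 1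
    have h2 : HasDerivAt (fun θ => Real.sin θ * Real.cos θ)
        (Real.cos θ * Real.cos θ + Real.sin θ * -Real.sin θ) θ :=
      (Real.hasDerivAt_sin θ).mul (Real.hasDerivAt_cos θ)
    refine ((h2.div (h1.sqrt (hpos θ).ne')
      (hspos θ).ne').const_mul m).congr_deriv ?_
    have hsq := Real.sq_sqrt (hpos θ).le
    have := hspos θ
    have := hpos θ
    set r := √(1 - m * Real.sin θ ^ 2)
    rw [← hsq]
    have hc : Real.cos θ ^ 2 = 1 - Real.sin θ ^ 2 := by
      linarith [Real.sin_sq_add_cos_sq θ]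
    field_simp
    rw [hsq]
    linear_combination m * hc
  have hcK' : Continuous fun θ => (1 - m) * (1 / √(1 - m * Real.sin θ ^ 2)) :=
    continuous_const.mul hcK
  have hcEK : Continuous fun θ =>
      √(1 - m * Real.sin θ ^ 2) - (1 - m) * (1 / √(1 - m * Real.sin θ ^ 2)) := hcE.sub hcK'
  have hcD' : Continuous fun θ => 2 * m * (1 - m) * (1 / 2 * Real.sin θ ^ 2 /
      ((1 - m * Real.sin θ ^ 2) * √(1 - m * Real.sin θ ^ 2))) := continuous_const.mul hcD
  have hint := intervalIntegral.integral_eq_sub_of_hasDerivAt (a := 0) (b := Real.pi / 2)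
    (fun θ _ => hd θ) ((hcEK.sub hcD').intervalIntegrable _ _)
  rw [intervalIntegral.integral_sub (hcEK.intervalIntegrable _ _) (hcD'.intervalIntegrable _ _),
    intervalIntegral.integral_sub (hcE.intervalIntegrable _ _) (hcK'.intervalIntegrable _ _),
    intervalIntegral.integral_const_mul,
    intervalIntegral.integral_const_mul] at hint
  simp only [Real.cos_pi_div_two, Real.sin_zero, mul_zero, zero_mul, zero_div, sub_zero] at hint
  have h1 : 0 < 1 - m := sub_pos.2 hm
  rw [eq_div_iff (by positivity), ellipticE, ellipticK]
  linarith

theorem hasDerivAt_ellipticK (hm0 : 0 < m) (hm : m < 1) :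
    HasDerivAt ellipticK ((ellipticE m - (1 - m) * ellipticK m) / (2 * m * (1 - m))) m := by
  have hpos := one_sub_mul_sin_sq_pos hm
  have hspos : ∀ θ, 0 < √(1 - m * Real.sin θ ^ 2) := fun θ => Real.sqrt_pos.2 (hpos θ)
  rw [← integral_sin_sq_div_eq_ellipticE_sub_ellipticK hm0 hm]
  refine UnifAnalyticAt.hasDerivAt_integral (by positivity)
    ((UnifAnalyticAt.const 1).div ((unifAnalyticAt_one_sub_mul_sin_sq m).sqrt fun θ _ => hpos θ)
      fun θ _ => (hspos θ).ne') fun θ _ => ?_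
  have h1 : HasDerivAt (fun m => 1 - m * Real.sin θ ^ 2) (-(Real.sin θ ^ 2)) m := by
    simpa using ((hasDerivAt_id m).mul_const (Real.sin θ ^ 2)).const_sub 1
  refine ((hasDerivAt_const m (1 : ℝ)).div (h1.sqrt (hpos θ).ne') (hspos θ).ne').congr_deriv ?_
  have := hspos θ
  have := hpos θ
  rw [Real.sq_sqrt (hpos θ).le]
  field_simp
  ring

theorem ellipticK_pos (hm : m < 1) : 0 < ellipticK m := by
  have hpos := one_sub_mul_sin_sq_pos hm
  have hspos : ∀ θ, 0 < √(1 - m * Real.sin θ ^ 2) := fun θ => Real.sqrt_pos.2 (hpos θ)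
  refine intervalIntegral.intervalIntegral_pos_of_pos (Continuous.intervalIntegrable
    (continuous_const.div (by fun_prop) fun θ => (hspos θ).ne') _ _)
    (fun θ => one_div_pos.2 (hspos θ)) (by positivity)

theorem ellipticE_pos (hm : m < 1) : 0 < ellipticE m :=
  intervalIntegral.intervalIntegral_pos_of_pos (Continuous.intervalIntegrable (by fun_prop) _ _)
    (fun θ => Real.sqrt_pos.2 (one_sub_mul_sin_sq_pos hm θ)) (by positivity)

theorem ellipticK_strictMono {m n : ℝ} (hmn : m < n) (hn : n < 1) :
    ellipticK m < ellipticK n := by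
  have hpos := one_sub_mul_sin_sq_pos hn
  have hle : ∀ θ, 1 - n * Real.sin θ ^ 2 ≤ 1 - m * Real.sin θ ^ 2 := fun θ => by
    nlinarith [sq_nonneg (Real.sin θ)]
  have hcont : ∀ {k : ℝ}, k < 1 → Continuous fun θ => 1 / √(1 - k * Real.sin θ ^ 2) := fun hk =>
    continuous_const.div (by fun_prop) fun θ =>
      (Real.sqrt_pos.2 (one_sub_mul_sin_sq_pos hk θ)).ne'
  refine intervalIntegral.integral_lt_integral_of_continuousOn_of_le_of_exists_lt
    (by positivity) (hcont (hmn.trans hn)).continuousOn (hcont hn).continuousOn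
    (fun θ _ => one_div_le_one_div_of_le (Real.sqrt_pos.2 (hpos θ)) (Real.sqrt_le_sqrt (hle θ)))
    ⟨Real.pi / 2, right_mem_Icc.2 (by positivity), ?_⟩
  refine one_div_lt_one_div_of_lt (Real.sqrt_pos.2 (hpos _)) (Real.sqrt_lt_sqrt (hpos _).le ?_)
  simpa using hmn

theorem ellipticE_strictAnti {m n : ℝ} (hmn : m < n) (hn : n < 1) :
    ellipticE n < ellipticE m := by
  have hpos := one_sub_mul_sin_sq_pos hn
  have hle : ∀ θ, 1 - n * Real.sin θ ^ 2 ≤ 1 - m * Real.sin θ ^ 2 := fun θ => by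
    nlinarith [sq_nonneg (Real.sin θ)]
  refine intervalIntegral.integral_lt_integral_of_continuousOn_of_le_of_exists_lt
    (by positivity) (by fun_prop) (by fun_prop) (fun θ _ => Real.sqrt_le_sqrt (hle θ))
    ⟨Real.pi / 2, right_mem_Icc.2 (by positivity), Real.sqrt_lt_sqrt (hpos _).le ?_⟩
  simpa using hmn

end Elliptic

/-! ### The diagonal α = β: divided differences as derivatives, and elliptic closed forms. -/

section Diagonal

variable {α τ : ℝ}

theorem m₁_mem (h0 : 0 < α) (h1 : α < τ) : 0 < m₁ α τ ∧ m₁ α τ < 1 := by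
  unfold m₁
  exact ⟨by positivity, (div_lt_one (by positivity)).2 (by nlinarith)⟩

theorem m₂_mem (h0 : 0 < α) (h1 : α < τ) : 0 < m₂ α τ ∧ m₂ α τ < 1 := by
  have hτ : 0 < τ := h0.trans h1
  unfold m₂
  refine ⟨by positivity, ?_⟩
  rw [div_mul_div_comm, div_lt_one (by positivity)]
  nlinarith

/-- The integral of `((α ^ 2 - ζ ^ 2) (τ ^ 2 - ζ ^ 2) (ζ ^ 2 + 4)) ^ (-1 / 2)` over `[-α, α]`. -/
noncomputable def midM (τ α : ℝ) : ℝ :=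
  ∫ θ in -(Real.pi / 2)..Real.pi / 2, 1 / √(midPoly τ ((α * Real.sin θ) ^ 2))

/-- The integral of `2 ζ ((ζ ^ 2 - α ^ 2) (τ ^ 2 - ζ ^ 2) (ζ ^ 2 + 4)) ^ (-1 / 2)` over
`[α, τ]`. -/
noncomputable def sideN (τ α : ℝ) : ℝ :=
  ∫ θ in -(Real.pi / 2)..Real.pi / 2, 2 * affineNode α τ (Real.sin θ) /
    √(sidePoly τ α (affineNode α τ (Real.sin θ)))

theorem midPoly_mul_sin_pos (h0 : 0 < α) (h1 : α < τ) (θ : ℝ) :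
    0 < midPoly τ ((α * Real.sin θ) ^ 2) := by
  have := Real.sin_mem_Icc θ
  exact midPoly_pos (by nlinarith [this.1]) (by nlinarith [this.2])

theorem affineNode_neg_self (α s : ℝ) : affineNode (-α) α s = α * s := by
  unfold affineNode
  ring

theorem continuous_one_div_sqrt_midPoly (h0 : 0 < α) (h1 : α < τ) :
    Continuous fun θ => 1 / √(midPoly τ ((α * Real.sin θ) ^ 2)) := by
  refine continuous_const.div ?_ fun θ => (Real.sqrt_pos.2 (midPoly_mul_sin_pos h0 h1 θ)).ne'
  unfold midPoly
  fun_prop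

theorem midI_diag (h0 : 0 < α) (h1 : α < τ) : midI α α τ = α * midM τ α := by
  have hc := continuous_one_div_sqrt_midPoly h0 h1
  have hodd : ∫ θ in -(Real.pi / 2)..Real.pi / 2,
      α * Real.sin θ * (1 / √(midPoly τ ((α * Real.sin θ) ^ 2))) = 0 :=
    intervalIntegral_eq_zero_of_odd (fun θ => by rw [Real.sin_neg, mul_neg, neg_sq]; ring) _
  have hc' : Continuous fun θ => α * Real.sin θ * (1 / √(midPoly τ ((α * Real.sin θ) ^ 2))) := by
    fun_prop
  have hcM : Continuous fun θ => α * (1 / √(midPoly τ ((α * Real.sin θ) ^ 2))) :=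
    continuous_const.mul hc
  rw [midI, midM, ← intervalIntegral.integral_const_mul, eq_comm,
    ← zero_add (∫ _ in _.._, _), ← hodd,
    ← intervalIntegral.integral_add (hc'.intervalIntegrable _ _)
      (hcM.intervalIntegrable _ _)]
  refine intervalIntegral.integral_congr fun θ _ => ?_
  simp only [affineNode_neg_self]
  ring

theorem sideA_add_sideB_diag (h0 : 0 < α) (h1 : α < τ) :
    sideA α α τ + sideB α α τ = sideN τ α := by
  have hA := (unifAnalyticAt_sideA (x₀ := (0 : ℝ)) (f := fun _ => α) (g := fun _ => α)
    (t := fun _ => τ) analyticAt_const analyticAt_const analyticAt_const (by linarith)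
    (by linarith) h1).intervalIntegrable neg_pi_div_two_le_pi_div_two
  have hB := (unifAnalyticAt_sideB (x₀ := (0 : ℝ)) (f := fun _ => α) (g := fun _ => α)
    (t := fun _ => τ) analyticAt_const analyticAt_const analyticAt_const (by linarith)
    (by linarith) h1).intervalIntegrable neg_pi_div_two_le_pi_div_two
  rw [sideA, sideB, sideN, ← intervalIntegral.integral_add hA hB]
  refine intervalIntegral.integral_congr fun θ _ => ?_
  ring

/-- On the diagonal the factor 1 + sin θ in `midDiff` splits its integrand into an odd part, which
integrates to zero, and α times the derivative of the integrand of `midM`. -/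
theorem hasDerivAt_midM (h0 : 0 < α) (h1 : α < τ) :
    HasDerivAt (midM τ) (midDiff α α τ / α) α := by
  have hpos := midPoly_mul_sin_pos h0 h1
  have hspos := fun θ => Real.sqrt_pos.2 (hpos θ)
  set D : ℝ → ℝ := fun θ => -(α * Real.sin θ ^ 2 *
      (τ ^ 2 - 4 - 2 * (α * Real.sin θ) ^ 2)) /
      (midPoly τ ((α * Real.sin θ) ^ 2) * √(midPoly τ ((α * Real.sin θ) ^ 2))) with hD
  have hu : UnifAnalyticAt (-(Real.pi / 2)) (Real.pi / 2)
      (fun α θ => 1 / √(midPoly τ ((α * Real.sin θ) ^ 2))) α := by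
    have hn : UnifAnalyticAt (-(Real.pi / 2)) (Real.pi / 2) (fun α θ => (α * Real.sin θ) ^ 2) α :=
      ((UnifAnalyticAt.of_analyticAt analyticAt_id).mul (.of_continuous Real.continuous_sin)).pow 2
    have hp : UnifAnalyticAt (-(Real.pi / 2)) (Real.pi / 2)
        (fun α θ => midPoly τ ((α * Real.sin θ) ^ 2)) α :=
      ((UnifAnalyticAt.const _).sub hn).mul ((UnifAnalyticAt.const 4).add hn)
    exact (UnifAnalyticAt.const 1).div (hp.sqrt fun θ _ => hpos θ) fun θ _ => (hspos θ).ne'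
  have hder := hu.hasDerivAt_integral (f' := D) neg_pi_div_two_le_pi_div_two fun θ _ => by
    have e1 : HasDerivAt (fun α => (α * Real.sin θ) ^ 2) (2 * α * Real.sin θ ^ 2) α := by
      refine (((hasDerivAt_id α).mul_const (Real.sin θ)).pow 2).congr_deriv ?_
      simp
      ring
    have e2 : HasDerivAt (fun α => midPoly τ ((α * Real.sin θ) ^ 2))
        (2 * α * Real.sin θ ^ 2 * (τ ^ 2 - 4 - 2 * (α * Real.sin θ) ^ 2)) α := by
      refine ((e1.const_sub (τ ^ 2)).mul (e1.const_add 4)).congr_deriv ?_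
      ring
    refine ((hasDerivAt_const α (1 : ℝ)).div (e2.sqrt (hpos θ).ne') (hspos θ).ne').congr_deriv ?_
    have := hspos θ
    have := hpos θ
    rw [Real.sq_sqrt (hpos θ).le]
    simp only [hD]
    field_simp
    ring
  refine hder.congr_deriv ?_
  have hcW : Continuous fun θ => midPoly τ ((α * Real.sin θ) ^ 2) := by
    unfold midPoly
    fun_prop
  have hcD : Continuous D :=
    Continuous.div (by fun_prop) (by fun_prop) fun θ => (mul_pos (hpos θ) (hspos θ)).ne'
  set O : ℝ → ℝ := fun θ => -(α ^ 2 * Real.sin θ *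
      (τ ^ 2 - 4 - 2 * (α * Real.sin θ) ^ 2)) /
      (midPoly τ ((α * Real.sin θ) ^ 2) * √(midPoly τ ((α * Real.sin θ) ^ 2))) with hO
  have hcO : Continuous O :=
    Continuous.div (by fun_prop) (by fun_prop) fun θ => (mul_pos (hpos θ) (hspos θ)).ne'
  have hodd : ∫ θ in -(Real.pi / 2)..Real.pi / 2, O θ = 0 :=
    intervalIntegral_eq_zero_of_odd (fun θ => by
      simp only [hO, Real.sin_neg, mul_neg, neg_sq, neg_mul, neg_div]) _
  have hcD' : Continuous fun θ => α * D θ := continuous_const.mul hcD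
  rw [eq_div_iff h0.ne', mul_comm, ← intervalIntegral.integral_const_mul, midDiff,
    ← zero_add (∫ _ in _.._, α * D _), ← hodd,
    ← intervalIntegral.integral_add (hcO.intervalIntegrable _ _)
      (hcD'.intervalIntegrable _ _)]
  refine intervalIntegral.integral_congr fun θ _ => ?_
  have := hspos θ
  have := hpos θ
  simp only [hO, hD, affineNode_neg_self]
  rw [Real.mul_self_sqrt (hpos θ).le]
  field_simp
  ring

/-- The two integrands differ by the exact derivative of cos θ / √(`sidePoly`), which vanishes at
±π/2. -/
theorem hasDerivAt_sideN (h0 : 0 < α) (h1 : α < τ) :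
    HasDerivAt (sideN τ) (2 * α * sideDiff α α τ) α := by
  have hpos : ∀ θ, 0 < sidePoly τ α (affineNode α τ (Real.sin θ)) :=
    sidePoly_affineNode_pos (by linarith) (by linarith) h1
  have hspos := fun θ => Real.sqrt_pos.2 (hpos θ)
  have hu : UnifAnalyticAt (-(Real.pi / 2)) (Real.pi / 2) (fun α θ =>
      2 * affineNode α τ (Real.sin θ) / √(sidePoly τ α (affineNode α τ (Real.sin θ)))) α :=
    ((UnifAnalyticAt.const 2).mul (unifAnalyticAt_affineNode analyticAt_id analyticAt_const)).div
      ((unifAnalyticAt_sidePoly analyticAt_id analyticAt_id analyticAt_const).sqrt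
        fun θ _ => hpos θ) fun θ _ => (hspos θ).ne'
  set z : ℝ → ℝ := fun θ => affineNode α τ (Real.sin θ) with hz
  replace hpos : ∀ θ, 0 < sidePoly τ α (z θ) := hpos
  replace hspos : ∀ θ, 0 < √(sidePoly τ α (z θ)) := hspos
  have hcz : Continuous z := by
    simp only [hz, affineNode]
    fun_prop
  have hcU : Continuous fun θ => sidePoly τ α (z θ) := by
    unfold sidePoly
    fun_prop
  -- the derivative of the integrand in `α`
  set D : ℝ → ℝ := fun θ => (1 - Real.sin θ) / √(sidePoly τ α (z θ)) -
      z θ * (((1 - Real.sin θ) / 2 + 1) * ((z θ + τ) * (z θ ^ 2 + 4)) +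
        (z θ + α) * ((1 - Real.sin θ) / 2) * (3 * z θ ^ 2 + 2 * τ * z θ + 4)) /
      (sidePoly τ α (z θ) * √(sidePoly τ α (z θ))) with hD
  have hcD : Continuous D :=
    (Continuous.div (by fun_prop) (by fun_prop) fun θ => (hspos θ).ne').sub
      (Continuous.div (by fun_prop) (by fun_prop) fun θ => (mul_pos (hpos θ) (hspos θ)).ne')
  have hder := hu.hasDerivAt_integral (f' := D) neg_pi_div_two_le_pi_div_two fun θ _ => by
    have e1 : HasDerivAt (fun α => affineNode α τ (Real.sin θ)) ((1 - Real.sin θ) / 2) α := by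
      refine ((((hasDerivAt_id α).add_const τ).div_const 2).add
        ((((hasDerivAt_id α).const_sub τ).div_const 2).mul_const (Real.sin θ))).congr_deriv ?_
      ring
    have e2 : HasDerivAt (fun α => sidePoly τ α (affineNode α τ (Real.sin θ)))
        (((1 - Real.sin θ) / 2 + 1) * ((z θ + τ) * (z θ ^ 2 + 4)) +
        (z θ + α) * ((1 - Real.sin θ) / 2) * (3 * z θ ^ 2 + 2 * τ * z θ + 4)) α := by
      refine ((e1.add (hasDerivAt_id α)).mul
        ((e1.add_const τ).mul ((e1.pow 2).add_const 4))).congr_deriv ?_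
      simp [hz]
      ring
    refine ((e1.const_mul 2).div (e2.sqrt (hpos θ).ne') (hspos θ).ne').congr_deriv ?_
    have hs := hspos θ
    have hr := Real.sq_sqrt (hpos θ).le
    change _ = (1 - Real.sin θ) / √(sidePoly τ α (z θ)) - _ / _
    change (_ * √(sidePoly τ α (z θ)) - 2 * z θ * (_ / (2 * √(sidePoly τ α (z θ))))) /
      √(sidePoly τ α (z θ)) ^ 2 = _
    generalize √(sidePoly τ α (z θ)) = r at *
    generalize sidePoly τ α (z θ) = U at *
    subst hr
    field_simp
  refine hder.congr_deriv ?_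
  set C : ℝ → ℝ := fun θ =>
    ((1 + Real.sin θ) / 2 * ((z θ + τ) * (z θ ^ 2 + 4)) -
      (z θ + α) * ((1 - Real.sin θ) / 2) * (3 * z θ ^ 2 + 2 * τ * z θ + 4)) /
      (2 * (sidePoly τ α (z θ) * √(sidePoly τ α (z θ)))) with hC
  have hcC : Continuous C :=
    Continuous.div (by fun_prop) (by fun_prop) fun θ => by
      have := hspos θ
      have := hpos θ
      positivity
  have hdiff : sideDiff α α τ = ∫ θ in -(Real.pi / 2)..Real.pi / 2, C θ := by
    refine intervalIntegral.integral_congr fun θ _ => ?_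
    have := hspos θ
    have := hpos θ
    simp only [hC]
    rw [Real.mul_self_sqrt (hpos θ).le]
    congr 1 <;> ring
  have hexact : ∀ θ, HasDerivAt (fun θ => Real.cos θ / √(sidePoly τ α (z θ)))
      (D θ - 2 * α * C θ) θ := fun θ => by
    have e1 : HasDerivAt z ((τ - α) / 2 * Real.cos θ) θ :=
      ((Real.hasDerivAt_sin θ).const_mul _).const_add _
    have e2 : HasDerivAt (fun θ => sidePoly τ α (z θ))
        (((z θ + τ) * (z θ ^ 2 + 4) + (z θ + α) * (3 * z θ ^ 2 + 2 * τ * z θ + 4)) *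
          ((τ - α) / 2 * Real.cos θ)) θ := by
      refine ((e1.add_const α).mul
        ((e1.add_const τ).mul ((e1.pow 2).add_const 4))).congr_deriv ?_
      simp
      ring
    refine ((Real.hasDerivAt_cos θ).div (e2.sqrt (hpos θ).ne') (hspos θ).ne').congr_deriv ?_
    have hs := hspos θ
    have hr := Real.sq_sqrt (hpos θ).le
    have hz' : (τ - α) / 2 * (1 + Real.sin θ) = z θ - α := by
      simp only [hz, affineNode]
      ring
    have key : -Real.sin θ * sidePoly τ α (z θ) - Real.cos θ * (((z θ + τ) * (z θ ^ 2 + 4) +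
        (z θ + α) * (3 * z θ ^ 2 + 2 * τ * z θ + 4)) * ((τ - α) / 2 * Real.cos θ)) / 2 =
        (1 - Real.sin θ) * sidePoly τ α (z θ) - z θ * (((1 - Real.sin θ) / 2 + 1) *
          ((z θ + τ) * (z θ ^ 2 + 4)) +
          (z θ + α) * ((1 - Real.sin θ) / 2) * (3 * z θ ^ 2 + 2 * τ * z θ + 4)) -
        α * ((1 + Real.sin θ) / 2 * ((z θ + τ) * (z θ ^ 2 + 4)) -
          (z θ + α) * ((1 - Real.sin θ) / 2) * (3 * z θ ^ 2 + 2 * τ * z θ + 4)) := by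
      rw [sidePoly]
      linear_combination -((τ - α) / 4) *
        ((z θ + τ) * (z θ ^ 2 + 4) + (z θ + α) * (3 * z θ ^ 2 + 2 * τ * z θ + 4)) *
          Real.sin_sq_add_cos_sq θ - (1 - Real.sin θ) / 2 *
        ((z θ + τ) * (z θ ^ 2 + 4) + (z θ + α) * (3 * z θ ^ 2 + 2 * τ * z θ + 4)) * hz'
    simp only [hD, hC]
    generalize √(sidePoly τ α (z θ)) = r at *
    generalize sidePoly τ α (z θ) = U at *
    subst hr
    generalize (z θ + τ) * (z θ ^ 2 + 4) = V at *
    generalize 3 * z θ ^ 2 + 2 * τ * z θ + 4 = V' at *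
    field_simp
    linear_combination 4 * key
  have hcC' : Continuous fun θ => 2 * α * C θ := continuous_const.mul hcC
  have hint := intervalIntegral.integral_eq_sub_of_hasDerivAt (a := -(Real.pi / 2))
    (b := Real.pi / 2) (fun θ _ => hexact θ) ((hcD.sub hcC').intervalIntegrable _ _)
  rw [intervalIntegral.integral_sub (hcD.intervalIntegrable _ _) (hcC'.intervalIntegrable _ _),
    intervalIntegral.integral_const_mul,
    Real.cos_neg, Real.cos_pi_div_two, zero_div, zero_div, sub_zero, ← hdiff] at hint
  linarith

/-- Undo z = α sin θ, then pass to Legendre form. In x = sin² φ the second substitution is z² =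
4α²x/(4 + α²(1 - x)), the Möbius map taking 0, 1, ∞ to 0, α², -4; the remaining branch point τ²
corresponds to x = 1/m₂. -/
theorem midM_eq (h0 : 0 < α) (h1 : α < τ) :
    midM τ α = 2 / (τ * √(α ^ 2 + 4)) * ellipticK (m₂ α τ) := by
  have hπ := Real.pi_pos
  have hτ : 0 < τ := h0.trans h1
  have hle : (0 : ℝ) ≤ Real.pi / 2 := by positivity
  set g : ℝ → ℝ := fun z => 1 / √((α ^ 2 - z ^ 2) * midPoly τ (z ^ 2)) with hg
  have hcos : ∀ θ ∈ Ioo 0 (Real.pi / 2), 0 < Real.cos θ := fun θ hθ =>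
    Real.cos_pos_of_mem_Ioo ⟨by linarith [hθ.1], hθ.2⟩
  have k1 : ∫ θ in (0 : ℝ)..Real.pi / 2, 1 / √(midPoly τ ((α * Real.sin θ) ^ 2)) =
      ∫ z in (0 : ℝ)..α, g z := by
    have key := intervalIntegral.integral_comp_mul_deriv_of_deriv_nonneg (g := g)
      (f := fun θ => α * Real.sin θ) (f' := fun θ => α * Real.cos θ)
      (a := 0) (b := Real.pi / 2) (by fun_prop)
      (fun θ _ => (Real.hasDerivAt_sin θ).const_mul α) (fun θ hθ => by
        rw [min_eq_left hle, max_eq_right hle] at hθ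
        have := hcos θ hθ
        positivity)
    simp only [Real.sin_zero, Real.sin_pi_div_two, mul_zero, mul_one] at key
    rw [← key, intervalIntegral.integral_of_le hle, intervalIntegral.integral_of_le hle,
      integral_Ioc_eq_integral_Ioo, integral_Ioc_eq_integral_Ioo]
    refine setIntegral_congr_fun measurableSet_Ioo fun θ hθ => ?_
    have hc := hcos θ hθ
    have hs := Real.sqrt_pos.2 (midPoly_mul_sin_pos h0 h1 θ)
    simp only [hg, Function.comp_apply]
    rw [show α ^ 2 - (α * Real.sin θ) ^ 2 = (α * Real.cos θ) ^ 2 by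
      linear_combination -α ^ 2 * Real.sin_sq_add_cos_sq θ, Real.sqrt_mul (by positivity),
      Real.sqrt_sq (by positivity)]
    field_simp
  have k2 : ∫ z in (0 : ℝ)..α, g z = ∫ φ in (0 : ℝ)..Real.pi / 2,
      1 / (τ * √(α ^ 2 + 4)) * (1 / √(1 - m₂ α τ * Real.sin φ ^ 2)) := by
    set Δ : ℝ → ℝ := fun φ => 4 + α ^ 2 * Real.cos φ ^ 2 with hΔ
    have hΔpos : ∀ φ, 0 < Δ φ := fun φ => by positivity
    have hΔs : ∀ φ, 0 < √(Δ φ) := fun φ => Real.sqrt_pos.2 (hΔpos φ)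
    have hd : ∀ φ, HasDerivAt (fun φ => 2 * α * Real.sin φ / √(Δ φ))
        (2 * α * (α ^ 2 + 4) * Real.cos φ / (Δ φ * √(Δ φ))) φ := fun φ => by
      have e1 : HasDerivAt Δ (-(2 * α ^ 2 * Real.cos φ * Real.sin φ)) φ := by
        refine ((((Real.hasDerivAt_cos φ).pow 2).const_mul (α ^ 2)).const_add 4).congr_deriv ?_
        simp
        ring
      refine (((Real.hasDerivAt_sin φ).const_mul (2 * α)).div (e1.sqrt (hΔpos φ).ne')
        (hΔs φ).ne').congr_deriv ?_
      have h2 := hΔs φ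
      have h3 := hΔpos φ
      have h4 : Δ φ + α ^ 2 * Real.sin φ ^ 2 = α ^ 2 + 4 := by
        simp only [hΔ]
        linear_combination α ^ 2 * Real.sin_sq_add_cos_sq φ
      rw [← h4, Real.sq_sqrt h3.le]
      nth_rw 6 [← Real.sq_sqrt h3.le]
      field_simp
      rw [Real.sq_sqrt h3.le]
      ring
    have key := intervalIntegral.integral_comp_mul_deriv_of_deriv_nonneg (g := g)
      (a := 0) (b := Real.pi / 2) (fun φ _ => (hd φ).continuousAt.continuousWithinAt)
      (fun φ _ => hd φ) (fun φ hφ => by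
        rw [min_eq_left hle, max_eq_right hle] at hφ
        have := hcos φ hφ
        have := hΔs φ
        have := hΔpos φ
        positivity)
    have e4 : √(4 : ℝ) = 2 := by
      rw [show (4 : ℝ) = 2 ^ 2 by norm_num]
      exact Real.sqrt_sq (by norm_num)
    have eα : 2 * α * 1 / 2 = α := by ring
    simp only [hΔ, Real.sin_zero, Real.sin_pi_div_two, Real.cos_pi_div_two, mul_zero, zero_div,
      ne_eq, OfNat.ofNat_ne_zero, not_false_eq_true, zero_pow, add_zero, e4, eα] at key
    rw [← key, intervalIntegral.integral_of_le hle, intervalIntegral.integral_of_le hle,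
      integral_Ioc_eq_integral_Ioo, integral_Ioc_eq_integral_Ioo]
    refine setIntegral_congr_fun measurableSet_Ioo fun φ hφ => ?_
    have hc := hcos φ hφ
    have h2 := hΔs φ
    have h3 := hΔpos φ
    have hm := Real.sqrt_pos.2 (one_sub_mul_sin_sq_pos (m₂_mem h0 h1).2 φ)
    have hr : 0 < √(α ^ 2 + 4) := by positivity
    simp only [hg, Function.comp_apply]
    change 1 / √((α ^ 2 - (2 * α * Real.sin φ / √(Δ φ)) ^ 2) *
      midPoly τ ((2 * α * Real.sin φ / √(Δ φ)) ^ 2)) *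
      (2 * α * (α ^ 2 + 4) * Real.cos φ / (Δ φ * √(Δ φ))) = _
    have hX : (α ^ 2 - (2 * α * Real.sin φ / √(Δ φ)) ^ 2) *
        midPoly τ ((2 * α * Real.sin φ / √(Δ φ)) ^ 2) =
        (2 * α * (α ^ 2 + 4) * Real.cos φ / (Δ φ * √(Δ φ))) ^ 2 *
          (τ ^ 2 * ((α ^ 2 + 4) * (1 - m₂ α τ * Real.sin φ ^ 2))) := by
      have hcs : Real.cos φ ^ 2 = 1 - Real.sin φ ^ 2 := by
        linarith [Real.sin_sq_add_cos_sq φ]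
      have hΔ' : Δ φ = 4 + α ^ 2 * (1 - Real.sin φ ^ 2) := by simp only [hΔ, hcs]
      rw [div_pow, div_pow, mul_pow (Δ φ), Real.sq_sqrt h3.le, mul_pow _ (Real.cos φ), hcs,
        midPoly, m₂]
      rw [hΔ'] at h3 ⊢
      field_simp
      ring
    rw [hX, Real.sqrt_mul (by positivity), Real.sqrt_sq (by positivity),
      Real.sqrt_mul (by positivity), Real.sqrt_sq hτ.le, Real.sqrt_mul (by positivity)]
    field_simp
  rw [midM, intervalIntegral_eq_two_mul_of_even (fun θ => by rw [Real.sin_neg, mul_neg, neg_sq])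
    (continuous_one_div_sqrt_midPoly h0 h1), k1, k2,
    intervalIntegral.integral_const_mul, ellipticK]
  ring

/-- Since 2z dz = d(z²), only the branch points α², τ², -4 of z² matter. The affine map z² = τ² -
(τ² - α²) sin² φ sends -4 to sin² φ = 1/(1 - m₁). -/
theorem sideN_eq (h0 : 0 < α) (h1 : α < τ) :
    sideN τ α = 2 / √(τ ^ 2 + 4) * ellipticKbar (m₁ α τ) := by
  have hπ := Real.pi_pos
  have hτ : 0 < τ := h0.trans h1
  have hle : (0 : ℝ) ≤ Real.pi / 2 := by positivity
  have hατ : 0 < τ ^ 2 - α ^ 2 := by nlinarith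
  set g : ℝ → ℝ := fun z => 2 * z / √((z ^ 2 - α ^ 2) * ((τ ^ 2 - z ^ 2) * (z ^ 2 + 4))) with hg
  have k1 : ∫ z in α..τ, g z = sideN τ α := by
    refine integral_eq_integral_affineNode_sin h1 (f := fun z => 2 * z / √(sidePoly τ α z))
      fun z hz => ?_
    have e1 : 0 < z - α := sub_pos.2 hz.1
    have e2 : 0 < τ - z := sub_pos.2 hz.2
    have e3 : 0 < z + α := by linarith
    have e4 : 0 < z + τ := by linarith
    have e5 : 0 < sidePoly τ α z := by unfold sidePoly; positivity
    simp only [hg]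
    rw [show (z ^ 2 - α ^ 2) * ((τ ^ 2 - z ^ 2) * (z ^ 2 + 4)) =
      ((z - α) * (τ - z)) * sidePoly τ α z by unfold sidePoly; ring,
      Real.sqrt_mul (mul_pos e1 e2).le (sidePoly τ α z)]
    have := Real.sqrt_pos.2 (mul_pos e1 e2)
    have := Real.sqrt_pos.2 e5
    field_simp
  -- Here z decreases from τ to α as φ increases, hence the reversed limits and the minus sign.
  have k2 : ∫ z in τ..α, g z = ∫ φ in (0 : ℝ)..Real.pi / 2,
      -(2 / √(τ ^ 2 + 4)) * (1 / √(1 - (1 - m₁ α τ) * Real.sin φ ^ 2)) := by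
    set Δ : ℝ → ℝ := fun φ => τ ^ 2 - (τ ^ 2 - α ^ 2) * Real.sin φ ^ 2 with hΔ
    have hΔpos : ∀ φ, 0 < Δ φ := fun φ => by
      have := Real.sin_sq_le_one φ
      simp only [hΔ]
      nlinarith [pow_pos h0 2]
    have hΔs : ∀ φ, 0 < √(Δ φ) := fun φ => Real.sqrt_pos.2 (hΔpos φ)
    have hd : ∀ φ, HasDerivAt (fun φ => √(Δ φ))
        (-((τ ^ 2 - α ^ 2) * Real.sin φ * Real.cos φ / √(Δ φ))) φ := fun φ => by
      have e1 : HasDerivAt Δ (-(2 * (τ ^ 2 - α ^ 2) * Real.sin φ * Real.cos φ)) φ := by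
        refine ((((Real.hasDerivAt_sin φ).pow 2).const_mul
          (τ ^ 2 - α ^ 2)).const_sub (τ ^ 2)).congr_deriv ?_
        simp
        ring
      refine (e1.sqrt (hΔpos φ).ne').congr_deriv ?_
      have := hΔs φ
      field_simp
    have hsc : ∀ φ ∈ Ioo 0 (Real.pi / 2), 0 < Real.sin φ ∧ 0 < Real.cos φ := fun φ hφ =>
      ⟨Real.sin_pos_of_mem_Ioo ⟨hφ.1, by linarith [hφ.2]⟩,
        Real.cos_pos_of_mem_Ioo ⟨by linarith [hφ.1], hφ.2⟩⟩
    have key := intervalIntegral.integral_comp_mul_deriv_of_deriv_nonpos (g := g)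
      (a := 0) (b := Real.pi / 2) (fun φ _ => (hd φ).continuousAt.continuousWithinAt)
      (fun φ _ => hd φ) (fun φ hφ => by
        rw [min_eq_left hle, max_eq_right hle] at hφ
        obtain ⟨hs, hc⟩ := hsc φ hφ
        have := hΔs φ
        rw [Left.neg_nonpos_iff]
        positivity)
    rw [show √(Δ 0) = τ by simp [hΔ, hτ.le], show √(Δ (Real.pi / 2)) = α by
      simp [hΔ, h0.le]] at key
    rw [← key, intervalIntegral.integral_of_le hle, intervalIntegral.integral_of_le hle,
      integral_Ioc_eq_integral_Ioo, integral_Ioc_eq_integral_Ioo]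
    refine setIntegral_congr_fun measurableSet_Ioo fun φ hφ => ?_
    obtain ⟨hs, hc⟩ := hsc φ hφ
    have h2 := hΔs φ
    have h3 := hΔpos φ
    have hm' := one_sub_mul_sin_sq_pos (m := 1 - m₁ α τ) (by linarith [(m₁_mem h0 h1).1]) φ
    have hm := Real.sqrt_pos.2 hm'
    have hr : 0 < √(τ ^ 2 + 4) := by positivity
    have hX : (Δ φ - α ^ 2) * ((τ ^ 2 - Δ φ) * (Δ φ + 4)) =
        ((τ ^ 2 - α ^ 2) * Real.sin φ * Real.cos φ) ^ 2 *
          ((τ ^ 2 + 4) * (1 - (1 - m₁ α τ) * Real.sin φ ^ 2)) := by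
      have hcs : Real.cos φ ^ 2 = 1 - Real.sin φ ^ 2 := by
        linarith [Real.sin_sq_add_cos_sq φ]
      simp only [hΔ, mul_pow, hcs, m₁]
      field_simp
      ring
    simp only [hg, Function.comp_apply]
    rw [Real.sq_sqrt h3.le, hX, Real.sqrt_mul (by positivity), Real.sqrt_sq (by positivity),
      Real.sqrt_mul (by positivity)]
    field_simp
  rw [← k1, intervalIntegral.integral_symm, k2, intervalIntegral.integral_const_mul, ellipticKbar,
    ellipticK]
  ring

end Diagonal

/-! ### The value of the extended quotient on the diagonal. -/

section DiagonalValue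

variable {α τ : ℝ}

theorem hasDerivAt_m₁ (α τ : ℝ) : HasDerivAt (fun α => m₁ α τ) (2 * α / (τ ^ 2 + 4)) α := by
  refine ((((hasDerivAt_id α).pow 2).add_const 4).div_const (τ ^ 2 + 4)).congr_deriv ?_
  simp

theorem hasDerivAt_m₂ (hτ : τ ≠ 0) : HasDerivAt (fun α => m₂ α τ)
    (8 * α * (τ ^ 2 + 4) / (τ ^ 2 * (α ^ 2 + 4) ^ 2)) α := by
  have h1 : HasDerivAt (fun α : ℝ => α ^ 2) (2 * α) α := by simpa using hasDerivAt_pow 2 α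
  have h2 : HasDerivAt (fun α : ℝ => (τ ^ 2 + 4) / (α ^ 2 + 4))
      (-((τ ^ 2 + 4) * (2 * α)) / (α ^ 2 + 4) ^ 2) α := by
    refine ((hasDerivAt_const α (τ ^ 2 + 4)).div (h1.add_const 4) (by positivity)).congr_deriv ?_
    ring
  refine ((h1.div_const (τ ^ 2)).mul h2).congr_deriv ?_
  field_simp
  ring

theorem one_sub_m₁ (α τ : ℝ) : 1 - m₁ α τ = (τ ^ 2 - α ^ 2) / (τ ^ 2 + 4) := by
  unfold m₁
  field_simp
  ring

theorem one_sub_m₂ (hτ : τ ≠ 0) (α : ℝ) :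
    1 - m₂ α τ = 4 * (τ ^ 2 - α ^ 2) / (τ ^ 2 * (α ^ 2 + 4)) := by
  unfold m₂
  field_simp
  ring

/-- Differentiate the closed form of `sideN`, valid near α, and compare with `hasDerivAt_sideN` by
uniqueness of derivatives. -/
theorem sideDiff_diag (h0 : 0 < α) (h1 : α < τ) :
    2 * α * sideDiff α α τ = 2 * α / (τ ^ 2 - α ^ 2) * (ellipticKbar (m₁ α τ) / √(τ ^ 2 + 4) -
      √(τ ^ 2 + 4) / (α ^ 2 + 4) * ellipticEbar (m₁ α τ)) := by
  obtain ⟨hm0, hm1⟩ := m₁_mem h0 h1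
  have hev : sideN τ =ᶠ[𝓝 α] fun α => 2 / √(τ ^ 2 + 4) * ellipticKbar (m₁ α τ) := by
    filter_upwards [Ioo_mem_nhds h0 h1] with x hx using sideN_eq hx.1 hx.2
  have hK := hasDerivAt_ellipticK (m := 1 - m₁ α τ) (by linarith) (by linarith)
  have h := (hK.comp α ((hasDerivAt_m₁ α τ).const_sub 1)).const_mul (2 / √(τ ^ 2 + 4))
  rw [(hasDerivAt_sideN h0 h1).unique (h.congr_of_eventuallyEq hev), sub_sub_cancel, ellipticKbar,
    ellipticEbar]
  generalize ellipticK _ = K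
  generalize ellipticE _ = E
  have hd : 0 < τ ^ 2 - α ^ 2 := by nlinarith
  have hT : 0 < √(τ ^ 2 + 4) := by positivity
  have hT2 : √(τ ^ 2 + 4) ^ 2 = τ ^ 2 + 4 := Real.sq_sqrt (by positivity)
  rw [one_sub_m₁, m₁]
  generalize √(τ ^ 2 + 4) = T at *
  rw [← hT2]
  field_simp
  ring

/-- Same method for `midM`; here the prefactor also depends on α and contributes the term -K(m₂). -/
theorem midDiff_diag (h0 : 0 < α) (h1 : α < τ) :
    midDiff α α τ = 2 / (τ * √(α ^ 2 + 4)) *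
      (τ ^ 2 / (τ ^ 2 - α ^ 2) * ellipticE (m₂ α τ) - ellipticK (m₂ α τ)) := by
  have hτ : 0 < τ := h0.trans h1
  obtain ⟨hm0, hm1⟩ := m₂_mem h0 h1
  have hev : midM τ =ᶠ[𝓝 α] fun α => 2 / (τ * √(α ^ 2 + 4)) * ellipticK (m₂ α τ) := by
    filter_upwards [Ioo_mem_nhds h0 h1] with x hx using midM_eq hx.1 hx.2
  have hK := hasDerivAt_ellipticK hm0 hm1
  have hr : 0 < √(α ^ 2 + 4) := by positivity
  have hr2 : √(α ^ 2 + 4) ^ 2 = α ^ 2 + 4 := Real.sq_sqrt (by positivity)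
  have hp : HasDerivAt (fun α : ℝ => 2 / (τ * √(α ^ 2 + 4)))
      (-(2 * α) / (τ * (√(α ^ 2 + 4) * (α ^ 2 + 4)))) α := by
    have h1 : HasDerivAt (fun α : ℝ => α ^ 2 + 4) (2 * α) α := by
      simpa using (hasDerivAt_pow 2 α).add_const 4
    refine ((hasDerivAt_const α (2 : ℝ)).div ((h1.sqrt (by positivity)).const_mul τ)
      (by positivity)).congr_deriv ?_
    generalize √(α ^ 2 + 4) = r at *
    rw [← hr2]
    field_simp
    ring
  have h := hp.mul (hK.comp α (hasDerivAt_m₂ hτ.ne'))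
  have hu := (hasDerivAt_midM h0 h1).unique (h.congr_of_eventuallyEq hev)
  rw [div_eq_iff h0.ne'] at hu
  rw [hu]
  simp only [Function.comp_apply]
  generalize ellipticE _ = E
  generalize ellipticK _ = K
  have hd : 0 < τ ^ 2 - α ^ 2 := by nlinarith
  rw [one_sub_m₂ hτ.ne', m₂]
  generalize √(α ^ 2 + 4) = r at *
  field_simp
  ring

/-- The products K̄(m₁)K(m₂) arise with weights α² from `sideDiff` and τ² - α² from `midDiff`. They
add up to τ², which then factors out of the whole numerator. -/
theorem quotQ_diag (h0 : 0 < α) (h1 : α < τ) :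
    quotQ (α, α, τ) =
      τ ^ 2 / α ^ 2 * (τ / (τ ^ 2 - α ^ 2)) * √((α ^ 2 + 4) / (τ ^ 2 + 4)) *
        ((ellipticKbar (m₁ α τ) * ellipticK (m₂ α τ) -
            ellipticKbar (m₁ α τ) * ellipticE (m₂ α τ) -
            m₂ α τ * ellipticEbar (m₁ α τ) * ellipticK (m₂ α τ)) /
          ellipticK (m₂ α τ) ^ 2) := by
  have hτ : 0 < τ := h0.trans h1
  have hK := ellipticK_pos (m₂_mem h0 h1).2
  have e : (α + α) * sideDiff α α τ = 2 * α * sideDiff α α τ := by ring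
  rw [quotQ]
  dsimp only
  rw [e, sideDiff_diag h0 h1, sideA_add_sideB_diag h0 h1, midDiff_diag h0 h1, midI_diag h0 h1,
    sideN_eq h0 h1, midM_eq h0 h1, Real.sqrt_div (by positivity)]
  have hd : 0 < τ ^ 2 - α ^ 2 := by nlinarith
  have hT : 0 < √(τ ^ 2 + 4) := by positivity
  have hT2 : √(τ ^ 2 + 4) ^ 2 = τ ^ 2 + 4 := Real.sq_sqrt (by positivity)
  have hr : 0 < √(α ^ 2 + 4) := by positivity
  have hr2 : √(α ^ 2 + 4) ^ 2 = α ^ 2 + 4 := Real.sq_sqrt (by positivity)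
  -- Only the coefficient m₂ is expanded; the arguments of the elliptic integrals stay opaque, so
  -- the rest is field algebra.
  rw [show m₂ α τ * ellipticEbar (m₁ α τ) * ellipticK (m₂ α τ) = α ^ 2 / τ ^ 2 *
    (√(τ ^ 2 + 4) ^ 2 / √(α ^ 2 + 4) ^ 2) * ellipticEbar (m₁ α τ) * ellipticK (m₂ α τ) by
      rw [hT2, hr2]; rfl, ← hr2]
  generalize ellipticK _ = K at *
  generalize ellipticE _ = E
  generalize ellipticKbar _ = K'
  generalize ellipticEbar _ = E'
  rw [Real.sqrt_sq hr.le]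
  generalize √(α ^ 2 + 4) = r at *
  generalize √(τ ^ 2 + 4) = T at *
  field_simp
  ring

/-- The quantity whose zeros are the diagonal zeros of the extended quotient. -/
noncomputable def diagH (α τ : ℝ) : ℝ :=
  ellipticKbar (m₁ α τ) * ellipticK (m₂ α τ) - ellipticKbar (m₁ α τ) * ellipticE (m₂ α τ) -
    m₂ α τ * ellipticEbar (m₁ α τ) * ellipticK (m₂ α τ)

theorem exists_quotQ_diag_eq (h0 : 0 < α) (h1 : α < τ) :
    ∃ c, 0 < c ∧ quotQ (α, α, τ) = c * diagH α τ := by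
  have hτ : 0 < τ := h0.trans h1
  have hK := ellipticK_pos (m₂_mem h0 h1).2
  have hd : 0 < τ ^ 2 - α ^ 2 := by nlinarith
  refine ⟨τ ^ 2 / α ^ 2 * (τ / (τ ^ 2 - α ^ 2)) * √((α ^ 2 + 4) / (τ ^ 2 + 4)) /
    ellipticK (m₂ α τ) ^ 2, by positivity, ?_⟩
  rw [quotQ_diag h0 h1, diagH]
  ring

end DiagonalValue

/-! ### Sign change along the diagonal and zeros off the diagonal. -/

section SignChange

/-- The value of `τ` with given elliptic parameters. -/
noncomputable def tauOf (m n : ℝ) : ℝ := √(4 * (1 - m) / (m * (1 - n)))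

/-- The value of `α` with given elliptic parameters. -/
noncomputable def alphaOf (m n : ℝ) : ℝ := √(m * n) * tauOf m n

variable {m n : ℝ}

theorem tauOf_pos (hm : m ∈ Ioo (0 : ℝ) 1) (hn : n ∈ Ioo (0 : ℝ) 1) : 0 < tauOf m n := by
  have := hm.1
  have := sub_pos.2 hm.2
  have := sub_pos.2 hn.2
  unfold tauOf
  positivity

theorem tauOf_sq (hm : m ∈ Ioo (0 : ℝ) 1) (hn : n ∈ Ioo (0 : ℝ) 1) :
    tauOf m n ^ 2 = 4 * (1 - m) / (m * (1 - n)) := by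
  have := hm.1
  have := sub_pos.2 hm.2
  have := sub_pos.2 hn.2
  exact Real.sq_sqrt (by positivity)

theorem alphaOf_sq (hm : m ∈ Ioo (0 : ℝ) 1) (hn : n ∈ Ioo (0 : ℝ) 1) :
    alphaOf m n ^ 2 = m * n * (4 * (1 - m) / (m * (1 - n))) := by
  have := hm.1
  have := hn.1
  rw [alphaOf, mul_pow, tauOf_sq hm hn, Real.sq_sqrt (by positivity)]

theorem alphaOf_mem (hm : m ∈ Ioo (0 : ℝ) 1) (hn : n ∈ Ioo (0 : ℝ) 1) :
    0 < alphaOf m n ∧ alphaOf m n < tauOf m n := by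
  have hτ := tauOf_pos hm hn
  have := hm.1
  have := hn.1
  refine ⟨by unfold alphaOf; positivity, mul_lt_of_lt_one_left hτ ?_⟩
  rw [Real.sqrt_lt' one_pos, one_pow]
  nlinarith [hm.2, hn.2]

theorem m₁_alphaOf_tauOf (hm : m ∈ Ioo (0 : ℝ) 1) (hn : n ∈ Ioo (0 : ℝ) 1) :
    m₁ (alphaOf m n) (tauOf m n) = m := by
  have h1 := hm.1
  have h3 := sub_pos.2 hn.2
  rw [m₁, div_eq_iff (by positivity), alphaOf_sq hm hn, tauOf_sq hm hn]
  field_simp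
  ring

theorem m₂_alphaOf_tauOf (hm : m ∈ Ioo (0 : ℝ) 1) (hn : n ∈ Ioo (0 : ℝ) 1) :
    m₂ (alphaOf m n) (tauOf m n) = n := by
  have h := m₁_alphaOf_tauOf hm hn
  have h1 := hm.1
  have h2 := hn.1
  have hτ := tauOf_pos hm hn
  rw [m₂, ← inv_div (alphaOf m n ^ 2 + 4), show (alphaOf m n ^ 2 + 4) / (tauOf m n ^ 2 + 4) = m
    from h, alphaOf, mul_pow, Real.sq_sqrt (by positivity)]
  field_simp

/-- From (1 - m₁)/(1 - m₂) = m₁τ²/4. -/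
theorem tauOf_m₁_m₂ {α τ : ℝ} (h0 : 0 < α) (h1 : α < τ) : tauOf (m₁ α τ) (m₂ α τ) = τ := by
  have hτ : 0 < τ := h0.trans h1
  have hd : 0 < τ ^ 2 - α ^ 2 := by nlinarith
  rw [tauOf, one_sub_m₁, one_sub_m₂ hτ.ne', m₁]
  refine (congrArg Real.sqrt ?_).trans (Real.sqrt_sq hτ.le)
  field_simp

/-- From m₁m₂ = (α/τ)². -/
theorem alphaOf_m₁_m₂ {α τ : ℝ} (h0 : 0 < α) (h1 : α < τ) : alphaOf (m₁ α τ) (m₂ α τ) = α := by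
  have hτ : 0 < τ := h0.trans h1
  rw [alphaOf, tauOf_m₁_m₂ h0 h1, show m₁ α τ * m₂ α τ = (α / τ) ^ 2 by
    unfold m₁ m₂; field_simp, Real.sqrt_sq (by positivity)]
  field_simp

theorem continuousAt_tauOf (hm : m ∈ Ioo (0 : ℝ) 1) (hn : n ∈ Ioo (0 : ℝ) 1) :
    ContinuousAt (fun m => tauOf m n) m := by
  have h : m * (1 - n) ≠ 0 := (mul_pos hm.1 (sub_pos.2 hn.2)).ne'
  unfold tauOf
  fun_prop (disch := assumption)

/-- Near a zero on the diagonal, `diagH` takes both signs. -/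
theorem diagH_sign_change {α τ : ℝ} (h0 : 0 < α) (h1 : α < τ) (h : diagH α τ = 0)
    {U : Set (ℝ × ℝ)} (hU : U ∈ 𝓝 (α, τ)) :
    (∃ p ∈ U, 0 < p.1 ∧ p.1 < p.2 ∧ 0 < diagH p.1 p.2) ∧
      ∃ p ∈ U, 0 < p.1 ∧ p.1 < p.2 ∧ diagH p.1 p.2 < 0 := by
  have hm := m₁_mem h0 h1
  have hn := m₂_mem h0 h1
  set m := m₁ α τ with hm_def
  set n := m₂ α τ with hn_def
  have hKn := ellipticK_pos hn.2
  have hE : ∀ {s : ℝ}, 0 < s → 0 < ellipticE (1 - s) := fun hs => ellipticE_pos (by linarith)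
  have hK : ∀ {s : ℝ}, 0 < s → 0 < ellipticK (1 - s) := fun hs => ellipticK_pos (by linarith)
  have hzero : ellipticK (1 - m) * (ellipticK n - ellipticE n) =
      n * ellipticK n * ellipticE (1 - m) := by
    rw [diagH, ← hm_def, ← hn_def, ellipticKbar, ellipticEbar] at h
    linarith
  -- The vanishing of `diagH` itself forces K(n) > E(n), since the other factors in `hzero` are
  -- positive.
  have hKE : 0 < ellipticK n - ellipticE n := by
    have : 0 < ellipticK (1 - m) * (ellipticK n - ellipticE n) := by
      rw [hzero]
      exact mul_pos (mul_pos hn.1 hKn) (hE hm.1)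
    exact pos_of_mul_pos_right this (hK hm.1).le
  have hnK := mul_pos hn.1 hKn
  have hτc := continuousAt_tauOf (m := m) (n := n) hm hn
  have hc : ContinuousAt (fun s => (alphaOf s n, tauOf s n)) m := by
    unfold alphaOf
    fun_prop
  have hV : ∀ᶠ s in 𝓝 m, (alphaOf s n, tauOf s n) ∈ U ∧ s ∈ Ioo (0 : ℝ) 1 := by
    refine (hc.eventually_mem ?_).and (Ioo_mem_nhds hm.1 hm.2)
    rwa [hm_def, hn_def, alphaOf_m₁_m₂ h0 h1, tauOf_m₁_m₂ h0 h1]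
  -- Along the curve m₂ = n only K(1 - s) and E(1 - s) vary. As s grows the first falls and the
  -- second rises, so the expression is strictly decreasing in s.
  have hval : ∀ s ∈ Ioo (0 : ℝ) 1, diagH (alphaOf s n) (tauOf s n) =
      ellipticK (1 - s) * (ellipticK n - ellipticE n) -
        n * ellipticK n * ellipticE (1 - s) := fun s hs => by
    rw [diagH, m₁_alphaOf_tauOf hs hn, m₂_alphaOf_tauOf hs hn, ellipticKbar, ellipticEbar]
    ring
  constructor
  · obtain ⟨s, ⟨hsU, hs⟩, hsm⟩ :=
      ((hV.filter_mono nhdsWithin_le_nhds).and self_mem_nhdsWithin : ∀ᶠ s in 𝓝[<] m, _).exists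
    have hsm : s < m := hsm
    refine ⟨_, hsU, (alphaOf_mem hs hn).1, (alphaOf_mem hs hn).2, ?_⟩
    have a1 := ellipticK_strictMono (m := 1 - m) (n := 1 - s) (by linarith) (by linarith [hs.1])
    have a2 := ellipticE_strictAnti (m := 1 - m) (n := 1 - s) (by linarith) (by linarith [hs.1])
    rw [hval s hs]
    nlinarith [mul_lt_mul_of_pos_right a1 hKE, mul_lt_mul_of_pos_left a2 hnK]
  · obtain ⟨s, ⟨hsU, hs⟩, hsm⟩ :=
      ((hV.filter_mono nhdsWithin_le_nhds).and self_mem_nhdsWithin : ∀ᶠ s in 𝓝[>] m, _).exists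
    have hsm : m < s := hsm
    refine ⟨_, hsU, (alphaOf_mem hs hn).1, (alphaOf_mem hs hn).2, ?_⟩
    have a1 := ellipticK_strictMono (m := 1 - s) (n := 1 - m) (by linarith) (by linarith [hm.1])
    have a2 := ellipticE_strictAnti (m := 1 - s) (n := 1 - m) (by linarith) (by linarith [hm.1])
    rw [hval s hs]
    nlinarith [mul_lt_mul_of_pos_right a1 hKE, mul_lt_mul_of_pos_left a2 hnK]

/-- The part of the parameter domain above the diagonal. -/
def upperDomain : Set (ℝ × ℝ × ℝ) := {p | 0 < p.1 ∧ p.1 < p.2.1 ∧ p.2.1 < p.2.2}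

theorem upperDomain_subset : upperDomain ⊆ simpleDomain := fun p hp =>
  ⟨by linarith [hp.2.1, hp.2.2], by linarith [hp.1, hp.2.1], hp.2.2⟩

theorem convex_upperDomain : Convex ℝ upperDomain := by
  have key : ∀ {x y a b : ℝ}, 0 < x → 0 < y → 0 ≤ a → 0 ≤ b → a + b = 1 → 0 < a * x + b * y :=
    fun {x y a b} hx hy ha hb hab => by
      have := convex_Ioi (0 : ℝ) hx hy ha hb hab
      simpa using this
  intro x hx y hy a b ha hb hab
  have k1 := key hx.1 hy.1 ha hb hab
  have k2 := key (sub_pos.2 hx.2.1) (sub_pos.2 hy.2.1) ha hb hab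
  have k3 := key (sub_pos.2 hx.2.2) (sub_pos.2 hy.2.2) ha hb hab
  refine ⟨?_, ?_, ?_⟩ <;>
    simp only [Prod.fst_add, Prod.snd_add, Prod.smul_fst, Prod.smul_snd, smul_eq_mul] <;> linarith

/-- The sign change is along the diagonal, but the zero must lie off it: both signs are first moved
into α < β. -/
theorem mem_closure_upperDomain_zeros {α τ : ℝ} (h0 : 0 < α) (h1 : α < τ) (h : diagH α τ = 0) :
    (α, α, τ) ∈ closure {p | p ∈ upperDomain ∧ quotQ p = 0} := by
  rw [Metric.mem_closure_iff]
  intro ε hε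
  have hcd : Continuous fun q : ℝ × ℝ => (q.1, q.1, q.2) := by fun_prop
  have hU : (fun q : ℝ × ℝ => (q.1, q.1, q.2)) ⁻¹' Metric.ball (α, α, τ) ε ∈ 𝓝 (α, τ) :=
    hcd.continuousAt.preimage_mem_nhds (Metric.ball_mem_nhds _ hε)
  have hdiag : ∀ {x y : ℝ}, 0 < x → x < y → (x, x, y) ∈ simpleDomain := fun {x y} hx hy => by
    refine ⟨?_, ?_, ?_⟩ <;> simp only <;> linarith
  -- An open condition on `quotQ` at a diagonal point survives a small increase of β.
  have push : ∀ (x y : ℝ) (S : Set ℝ), 0 < x → x < y → (x, x, y) ∈ Metric.ball (α, α, τ) ε →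
      IsOpen S → quotQ (x, x, y) ∈ S →
      ∃ p ∈ Metric.ball (α, α, τ) ε ∩ upperDomain, quotQ p ∈ S := by
    intro x y S hx hxy hb hS hq
    have hc : ContinuousAt (fun δ : ℝ => (x, x + δ, y)) 0 := by fun_prop
    have e0 : (x, x + 0, y) = (x, x, y) := by rw [add_zero]
    have hq' : ∀ᶠ p in 𝓝 (x, x + 0, y), quotQ p ∈ S := by
      rw [e0]
      exact (analyticOnNhd_quotQ _ (hdiag hx hxy)).continuousAt.eventually_mem (hS.mem_nhds hq)
    have hb' : ∀ᶠ p in 𝓝 (x, x + 0, y), p ∈ Metric.ball (α, α, τ) ε := by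
      rw [e0]
      exact Metric.isOpen_ball.mem_nhds hb
    have hδ : ∀ᶠ δ in 𝓝[>] (0 : ℝ), δ ∈ Ioo 0 (y - x) :=
      Ioo_mem_nhdsGT (sub_pos.2 hxy)
    obtain ⟨δ, ⟨hδ1, hδ2⟩, hδ3⟩ :=
      ((((hc.eventually hq').and (hc.eventually hb')).filter_mono nhdsWithin_le_nhds).and hδ).exists
    exact ⟨_, ⟨hδ2, hx, by simp only; linarith [hδ3.1], by simp only; linarith [hδ3.2]⟩, hδ1⟩
  obtain ⟨⟨p, hpU, hp0, hp1, hp⟩, q, hqU, hq0, hq1, hq⟩ := diagH_sign_change h0 h1 h hU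
  obtain ⟨c, hc, hcp⟩ := exists_quotQ_diag_eq hp0 hp1
  obtain ⟨d, hd, hdq⟩ := exists_quotQ_diag_eq hq0 hq1
  obtain ⟨p', hp', hp'S⟩ := push p.1 p.2 (Ioi 0) hp0 hp1 hpU isOpen_Ioi
    (by rw [hcp]; exact mul_pos hc hp)
  obtain ⟨q', hq', hq'S⟩ := push q.1 q.2 (Iio 0) hq0 hq1 hqU isOpen_Iio
    (by rw [hdq]; exact mul_neg_of_pos_of_neg hd hq)
  -- A ball cut with the convex region α < β is convex, so the two points of opposite sign are
  -- joined without meeting the diagonal.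
  have hconv : IsPreconnected (Metric.ball (α, α, τ) ε ∩ upperDomain) :=
    ((convex_ball _ _).inter convex_upperDomain).isPreconnected
  obtain ⟨r, hr, hr0⟩ := hconv.intermediate_value hq' hp'
    (analyticOnNhd_quotQ.continuousOn.mono (inter_subset_right.trans upperDomain_subset))
    (⟨(mem_Iio.1 hq'S).le, (mem_Ioi.1 hp'S).le⟩ : (0 : ℝ) ∈ Icc _ _)
  exact ⟨r, ⟨hr.2, hr0⟩, by rw [dist_comm]; exact hr.1⟩

end SignChange

/-! ### Transfer between (α, β, τ) and (a, b, t). -/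

section Loci

/-- The positive solution `z` of `z - 1 / z = x`. -/
noncomputable def posRoot (x : ℝ) : ℝ := (x + √(x ^ 2 + 4)) / 2

theorem posRoot_pos (x : ℝ) : 0 < posRoot x := by
  have : |x| < √(x ^ 2 + 4) := Real.lt_sqrt_of_sq_lt (by rw [sq_abs]; linarith)
  have := neg_abs_le x
  unfold posRoot
  linarith

theorem posRoot_mul_posRoot_neg (x : ℝ) : posRoot x * posRoot (-x) = 1 := by
  have := Real.sq_sqrt (show 0 ≤ x ^ 2 + 4 by positivity)
  rw [posRoot, posRoot, neg_sq]
  linear_combination this / 4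

/-- Turns 1/a < b into -α < β, by monotonicity of `posRoot`. -/
theorem one_div_posRoot (x : ℝ) : 1 / posRoot x = posRoot (-x) := by
  rw [div_eq_iff (posRoot_pos x).ne', mul_comm, posRoot_mul_posRoot_neg]

theorem posRoot_sub_one_div (x : ℝ) : posRoot x - 1 / posRoot x = x := by
  rw [one_div_posRoot, posRoot, posRoot, neg_sq]
  ring

theorem sub_one_div_strictMonoOn : StrictMonoOn (fun z : ℝ => z - 1 / z) (Ioi 0) :=
  fun _ hx _ _ hxy => by
    have := one_div_lt_one_div_of_lt hx hxy
    simp only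
    linarith

theorem posRoot_strictMono : StrictMono posRoot := fun x y hxy => by
  rw [← sub_one_div_strictMonoOn.lt_iff_lt (posRoot_pos x) (posRoot_pos y)]
  simpa only [posRoot_sub_one_div] using hxy

theorem posRoot_of_pos {a : ℝ} (ha : 0 < a) : posRoot (a - 1 / a) = a :=
  sub_one_div_strictMonoOn.injOn (posRoot_pos _) ha (posRoot_sub_one_div _)

theorem continuous_posRoot : Continuous posRoot := by
  unfold posRoot
  fun_prop

theorem sub_one_div_mem {a b t : ℝ} (ht : 0 < 1 / t) (hta : 1 / t < 1 / a) (hab : 1 / a < b)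
    (hbt : b < t) : (a - 1 / a, b - 1 / b, t - 1 / t) ∈ simpleDomain := by
  have ht0 : 0 < t := one_div_pos.1 ht
  have ha0 : 0 < a := one_div_pos.1 (ht.trans hta)
  have hb0 : 0 < b := (ht.trans hta).trans hab
  have hat : a < t := (one_div_lt_one_div ht0 ha0).1 hta
  have hba : 1 / b < a := (one_div_lt ha0 hb0).1 hab
  have hbt' : 1 / t < 1 / b := (one_div_lt_one_div ht0 hb0).2 hbt
  refine ⟨?_, ?_, ?_⟩ <;> simp only <;> linarith

/-- Injectivity of z ↦ z - 1/z on the positive axis gives α ≠ β, so the factor β - α of Q can be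
cancelled. -/
theorem quotQ_eq_zero_of_mem_oH {p : ℝ × ℝ × ℝ} (hp : p ∈ oH) :
    quotQ (p.1 - 1 / p.1, p.2.1 - 1 / p.2.1, p.2.2 - 1 / p.2.2) = 0 := by
  obtain ⟨a, b, t, rfl, hQ, hne, ht, hta, hab, hbt⟩ := hp
  obtain ⟨d1, d2, d3⟩ := sub_one_div_mem ht hta hab hbt
  have ha0 : 0 < a := one_div_pos.1 (ht.trans hta)
  have hb0 : 0 < b := (ht.trans hta).trans hab
  rw [Q_eq_simpleQ ht hta hab hbt, simpleQ_eq_mul_quotQ d1 d2 d3] at hQ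
  refine (mul_eq_zero.1 hQ).resolve_left fun h => hne ?_
  exact sub_one_div_strictMonoOn.injOn ha0 hb0 (sub_eq_zero.1 h).symm

theorem posRoot_mem_oH {p : ℝ × ℝ × ℝ} (hp : p ∈ upperDomain) (h : quotQ p = 0) :
    (posRoot p.1, posRoot p.2.1, posRoot p.2.2) ∈ oH := by
  obtain ⟨α, β, τ⟩ := p
  obtain ⟨d1, d2, d3⟩ := upperDomain_subset hp
  obtain ⟨h1, h2, h3⟩ := hp
  simp only at d1 d2 d3 h1 h2 h3
  have c1 : 0 < 1 / posRoot τ := one_div_pos.2 (posRoot_pos τ)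
  have c2 : 1 / posRoot τ < 1 / posRoot α :=
    one_div_lt_one_div_of_lt (posRoot_pos α) (posRoot_strictMono (by linarith))
  have c3 : 1 / posRoot α < posRoot β := by
    rw [one_div_posRoot]
    exact posRoot_strictMono d2
  have c4 : posRoot β < posRoot τ := posRoot_strictMono d3
  refine ⟨_, _, _, rfl, ?_, (posRoot_strictMono h2).ne, c1, c2, c3, c4⟩
  rw [Q_eq_simpleQ c1 c2 c3 c4]
  simp only [posRoot_sub_one_div]
  rw [simpleQ_eq_mul_quotQ d1 d2 d3, h, mul_zero]

/-- Forward, a nonzero value of `quotQ` at the limit would persist nearby, where oH has points.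
Backward, the continuous map `posRoot` carries zeros above the diagonal into oH. -/
theorem mem_closure_oH_iff {a t : ℝ} (ht : 0 < 1 / t) (hta : 1 / t < 1 / a) (hab : 1 / a < a)
    (hat : a < t) : (a, a, t) ∈ closure oH ↔ diagH (a - 1 / a) (t - 1 / t) = 0 := by
  have ht0 : 0 < t := one_div_pos.1 ht
  have ha0 : 0 < a := one_div_pos.1 (ht.trans hta)
  have hα : 0 < a - 1 / a := sub_pos.2 hab
  have hατ : a - 1 / a < t - 1 / t := by linarith
  obtain ⟨c, hc, hq⟩ := exists_quotQ_diag_eq hα hατ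
  constructor
  · intro h
    have hcont : ContinuousAt (fun p : ℝ × ℝ × ℝ =>
        quotQ (p.1 - 1 / p.1, p.2.1 - 1 / p.2.1, p.2.2 - 1 / p.2.2)) (a, a, t) := by
      have h1 : ContinuousAt (fun p : ℝ × ℝ × ℝ =>
          (p.1 - 1 / p.1, p.2.1 - 1 / p.2.1, p.2.2 - 1 / p.2.2)) (a, a, t) := by
        have := ha0.ne'
        have := ht0.ne'
        fun_prop (disch := assumption)
      exact ContinuousAt.comp (g := quotQ)
        (analyticOnNhd_quotQ _ (sub_one_div_mem ht hta hab hat)).continuousAt h1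
    by_contra hne
    have hne' : quotQ (a - 1 / a, a - 1 / a, t - 1 / t) ≠ 0 := by
      rw [hq]
      exact mul_ne_zero hc.ne' hne
    obtain ⟨p, hp, hp'⟩ :=
      ((mem_closure_iff_frequently.1 h).and_eventually (hcont.eventually_ne hne')).exists
    exact hp' (quotQ_eq_zero_of_mem_oH hp)
  · intro h
    have hΨ : Continuous fun p : ℝ × ℝ × ℝ => (posRoot p.1, posRoot p.2.1, posRoot p.2.2) := by
      have := continuous_posRoot
      fun_prop
    have := map_mem_closure hΨ (mem_closure_upperDomain_zeros hα hατ h)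
      (fun p hp => posRoot_mem_oH hp.1 hp.2)
    simpa only [posRoot_of_pos ha0, posRoot_of_pos ht0] using this

theorem mem_oP {a t : ℝ} (ht : 0 < 1 / t) (hta : 1 / t < 1 / a) (hab : 1 / a < a)
    (hat : a < t) : (a, a, t) ∈ oP := by
  refine ⟨a, a, t, rfl, ?_, rfl, ht, hta, hab, hat⟩
  rw [Q_eq_simpleQ ht hta hab hat]
  exact simpleQ_diag (sub_pos.2 hab) (by linarith)

theorem closure_oH_inter_oP :
    closure oH ∩ oP =
      {p : ℝ × ℝ × ℝ | ∃ a b t α τ : ℝ, p = (a, b, t) ∧ a = b ∧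
        0 < 1 / t ∧ 1 / t < 1 / a ∧ 1 / a < b ∧ b < t ∧
        α = a - 1 / a ∧ τ = t - 1 / t ∧
        ellipticKbar (m₁ α τ) * ellipticE (m₂ α τ) +
            m₂ α τ * ellipticEbar (m₁ α τ) * ellipticK (m₂ α τ) =
          ellipticKbar (m₁ α τ) * ellipticK (m₂ α τ)} := by
  ext p
  constructor
  · rintro ⟨hH, a, b, t, rfl, -, rfl, ht, hta, hab, hbt⟩
    refine ⟨a, a, t, _, _, rfl, rfl, ht, hta, hab, hbt, rfl, rfl, ?_⟩
    have := (mem_closure_oH_iff ht hta hab hbt).1 hH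
    unfold diagH at this
    linarith
  · rintro ⟨a, b, t, α, τ, rfl, rfl, ht, hta, hab, hbt, rfl, rfl, h⟩
    refine ⟨(mem_closure_oH_iff ht hta hab hbt).2 ?_, mem_oP ht hta hab hbt⟩
    unfold diagH
    linarith

end Loci

end Proof

end OrthoTPMS

open OrthoTPMS in
theorem mainTheorem5 :
    -- the substitution `ζ = z - 1 / z` does not change the period quotient
    (∀ a b t : ℝ, 0 < 1 / t → 1 / t < 1 / a → 1 / a < b → b < t →
      Q a b t = simpleQ (a - 1 / a) (b - 1 / b) (t - 1 / t)) ∧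
    -- the elliptic parameters are in the open unit interval
    (∀ α τ : ℝ, 0 < α → α < τ →
      (0 < m₁ α τ ∧ m₁ α τ < 1) ∧ (0 < m₂ α τ ∧ m₂ α τ < 1)) ∧
    -- the intersection of the closure of `oH` with `oP`
    (closure oH ∩ oP =
      {p : ℝ × ℝ × ℝ | ∃ a b t α τ : ℝ, p = (a, b, t) ∧ a = b ∧
        0 < 1 / t ∧ 1 / t < 1 / a ∧ 1 / a < b ∧ b < t ∧
        α = a - 1 / a ∧ τ = t - 1 / t ∧
        ellipticKbar (m₁ α τ) * ellipticE (m₂ α τ) +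
            m₂ α τ * ellipticEbar (m₁ α τ) * ellipticK (m₂ α τ) =
          ellipticKbar (m₁ α τ) * ellipticK (m₂ α τ)}) ∧
    -- the analytic extension of `Q / (β - α)` to `α = β`
    (∃ Qt : ℝ × ℝ × ℝ → ℝ, AnalyticOnNhd ℝ Qt simpleDomain ∧
      (∀ α β τ : ℝ, (α, β, τ) ∈ simpleDomain → α ≠ β →
        Qt (α, β, τ) = simpleQ α β τ / (β - α)) ∧
      (∀ α τ : ℝ, 0 < α → α < τ →
        Qt (α, α, τ) =
          τ ^ 2 / α ^ 2 * (τ / (τ ^ 2 - α ^ 2)) * Real.sqrt ((α ^ 2 + 4) / (τ ^ 2 + 4)) *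
            ((ellipticKbar (m₁ α τ) * ellipticK (m₂ α τ) -
                ellipticKbar (m₁ α τ) * ellipticE (m₂ α τ) -
                m₂ α τ * ellipticEbar (m₁ α τ) * ellipticK (m₂ α τ)) /
              ellipticK (m₂ α τ) ^ 2))) := by
  refine ⟨fun a b t ht hta hab hbt => Q_eq_simpleQ ht hta hab hbt,
    fun α τ h0 h1 => ⟨m₁_mem h0 h1, m₂_mem h0 h1⟩, closure_oH_inter_oP, quotQ,
    analyticOnNhd_quotQ, fun α β τ hp hne => ?_, fun α τ h0 h1 => quotQ_diag h0 h1⟩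
  rw [simpleQ_eq_mul_quotQ hp.1 hp.2.1 hp.2.2, mul_div_cancel_left₀ _ (sub_ne_zero.2 hne.symm)]
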